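/- Let $M$ be a complex manifold of dimension $n$, let $V\subset M$ be a complex submanifold of dimension $d$, and let $F$ be a non-singular holomorphic distribution of dimension $p$ on $M$, that is, a holomorphic subbundle $F\subset TM$ of rank $p$. Assume that $F$ leaves $V$ invariant, i.e. $F_V:=F|_V\subset TV$. Let $N_V=TM|_V/TV$ be the normal bundle and $\pi:TM|_V\to N_V$ the projection. The Camacho–Sad action of $F_V$ on $N_V$ is defined, for $C^\infty$ sections $u$ of $F_V$ and $\nu$ of $N_V$, by $\alpha(u,\nu)=\pi([\tilde u,\tilde v]|_V)$, where $\tilde u$ and $\tilde v$ are (local) $C^\infty$ sections of $F$ and $TM$ with $\tilde u|_V=u$ and $\pi(\tilde v|_V)=\nu$ (here $TM$ is identified with $T^{1,0}M$; the result does not depend on the choice of $\tilde u,\tilde v$). Let $\nabla$ be a connection for $N_V$ such that 1. $\nabla$ is an $F_V$-connection: it is of type $(1,0)$ (its connection matrix with respect to any local holomorphic frame of $N_V$ consists of $(1,0)$-forms) and $\nabla_u\nu=\alpha(u,\nu)$ for all $C^\infty$ sections $u$ of $F_V$ and $\nu$ of $N_V$; 2. $\nabla$ is Hermitian: there is a Hermitian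 metric $h$ on $N_V$ with $d\,h(s,t)=h(\nabla s,t)+h(s,\nabla t)$ for all $C^\infty$ sections $s,t$ of $N_V$. Let $\varphi$ be a polynomial on complex $(n-d)\times(n-d)$ matrices that is invariant under conjugation and homogeneous of degree $k>d-p$. Then $$\varphi(\nabla)\equiv 0,$$ where $\varphi(\nabla)=\bigl(\tfrac{\sqrt{-1}}{2\pi}\bigr)^k\varphi(K)$ is the $2k$-form on $V$ obtained from the curvature $K=\nabla\circ\nabla$ of $\nabla$, given locally by $\bigl(\tfrac{\sqrt{-1}}{2\pi}\bigr)^k\varphi(\kappa)$ with $\kappa$ the curvature matrix in a frame of $N_V$. -/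

import Mathlib

open scoped Manifold ContDiff

noncomputable section

namespace CamachoSad

/-!
Complex manifolds are manifolds modelled on a finite-dimensional complex normed space `E`, with the
model `𝓘(ℂ, E)`. The tangent space `TangentSpace 𝓘(ℂ, E) y` plays two roles, identified as usual:
it is the holomorphic tangent space `T_y M = T^{1,0}_y M` (a complex vector space) and it is the
real tangent space, `v` corresponding to `v^{1,0} = (v - i J v) / 2` with `J v = I • v`.
-/

/-- A complex manifold is a real manifold of the same class. -/
instance isManifold_real {E : Type*} [NormedAddCommGroup E] [NormedSpace ℂ E]
    {M : Type*} [TopologicalSpace M] [ChartedSpace E M] {m : ℕ∞ω} [IsManifold 𝓘(ℂ, E) m M] :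
    IsManifold 𝓘(ℝ, E) m M := by
  refine isManifold_of_contDiffOn 𝓘(ℝ, E) m M fun e e' he he' => ?_
  have h := (contDiffGroupoid m 𝓘(ℂ, E)).compatible he he'
  rw [contDiffGroupoid, mem_groupoid_of_pregroupoid] at h
  exact (show ContDiffOn ℂ m _ _ from h.1).restrict_scalars ℝ

section Fields

variable {E : Type*} [NormedAddCommGroup E] [NormedSpace ℂ E]
  {M : Type*} [TopologicalSpace M] [ChartedSpace E M]

/-- A section of `TM`, seen as a section of the real tangent bundle. -/
def realField (A : Π y : M, TangentSpace 𝓘(ℂ, E) y) : Π y : M, TangentSpace 𝓘(ℝ, E) y :=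
  fun y => A y

/-- The section `A` of `TM` is of (real) class `C^∞` on the set `U`. -/
def SmoothFieldOn [IsManifold 𝓘(ℂ, E) ω M] (A : Π y : M, TangentSpace 𝓘(ℂ, E) y) (U : Set M) :
    Prop :=
  ContMDiffOn 𝓘(ℝ, E) 𝓘(ℝ, E).tangent ∞
    (fun y => (⟨y, realField A y⟩ : TangentBundle 𝓘(ℝ, E) M)) U

/-- The section `A` of `TM` is holomorphic on the set `U`. -/
def HolomorphicFieldOn [IsManifold 𝓘(ℂ, E) ω M] (A : Π y : M, TangentSpace 𝓘(ℂ, E) y)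
    (U : Set M) : Prop :=
  ContMDiffOn 𝓘(ℂ, E) 𝓘(ℂ, E).tangent ω
    (fun y => (⟨y, A y⟩ : TangentBundle 𝓘(ℂ, E) M)) U

/-- The Lie bracket of two real vector fields. -/
def realBracket (A B : Π y : M, TangentSpace 𝓘(ℂ, E) y) : Π y : M, TangentSpace 𝓘(ℂ, E) y :=
  fun y => VectorField.mlieBracket 𝓘(ℝ, E) (realField A) (realField B) y

/-- The Lie bracket of two `C^∞` sections of `TM = T^{1,0}M`. Expanding
`[A - i J A, B - i J B] / 4` bilinearly, one finds `(C - i J C) / 2` with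
`C = ([A, B] - [J A, J B]) / 2`; in holomorphic coordinates this is
`∑ j, (∑ i, A^i ∂_i B^j - B^i ∂_i A^j) ∂_j`. -/
def bracket (A B : Π y : M, TangentSpace 𝓘(ℂ, E) y) : Π y : M, TangentSpace 𝓘(ℂ, E) y :=
  fun y => (1 / 2 : ℂ) • (realBracket A B y -
    realBracket (fun z => Complex.I • A z) (fun z => Complex.I • B z) y)

/-- A (non-singular) holomorphic distribution of dimension `p`: a holomorphic subbundle of rank `p`
of `TM`, that is, a family of subspaces locally spanned by `p` holomorphic vector fields that are
linearly independent at every point. -/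
def IsDistribution [IsManifold 𝓘(ℂ, E) ω M] (F : Π y : M, Submodule ℂ (TangentSpace 𝓘(ℂ, E) y))
    (p : ℕ) : Prop :=
  ∀ y₀ : M, ∃ U : Set M, IsOpen U ∧ y₀ ∈ U ∧
    ∃ A : Fin p → Π y : M, TangentSpace 𝓘(ℂ, E) y,
      (∀ i, HolomorphicFieldOn (A i) U) ∧
      ∀ y ∈ U, LinearIndependent ℂ (fun i => A i y) ∧
        Submodule.span ℂ (Set.range fun i => A i y) = F y

/-- A complex valued function of (real) class `C^∞`. -/
def SmoothFun (f : M → ℂ) : Prop := ContMDiff 𝓘(ℝ, E) 𝓘(ℝ, ℂ) ∞ f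

/-- The differential of a complex valued function, on real tangent vectors. -/
def differential (f : M → ℂ) (x : M) (v : TangentSpace 𝓘(ℂ, E) x) : ℂ :=
  NormedSpace.fromTangentSpace (𝕜 := ℝ) (f x)
    (mfderiv 𝓘(ℝ, E) 𝓘(ℝ, ℂ) f x (show TangentSpace 𝓘(ℝ, E) x from v))

end Fields

section Normal

variable {E : Type*} [NormedAddCommGroup E] [NormedSpace ℂ E]
  {G : Type*} [NormedAddCommGroup G] [NormedSpace ℂ G]
  {M : Type*} [TopologicalSpace M] [ChartedSpace E M]
  {V : Type*} [TopologicalSpace V] [ChartedSpace G V]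

/-- The subspace `T_x V` of `T_x M`, for a submanifold given by its inclusion `ι : V → M`. -/
def tangentImage (ι : V → M) (x : V) : Submodule ℂ (TangentSpace 𝓘(ℂ, E) (ι x)) :=
  LinearMap.range (mfderiv 𝓘(ℂ, G) 𝓘(ℂ, E) ι x).toLinearMap

/-- The fibre at `x` of the normal bundle `N_V = TM|_V / TV`. -/
abbrev NormalSpace (ι : V → M) (x : V) : Type _ :=
  TangentSpace 𝓘(ℂ, E) (ι x) ⧸ tangentImage (E := E) (G := G) ι x

/-- On the set `U` of points of `M`, the section `A` of `TM` induces the section `s` of `N_V`. -/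
def Induces (ι : V → M) (A : Π y : M, TangentSpace 𝓘(ℂ, E) y)
    (s : Π x : V, NormalSpace (E := E) (G := G) ι x) (U : Set M) : Prop :=
  ∀ x : V, ι x ∈ U → s x = (tangentImage (E := E) (G := G) ι x).mkQ (A (ι x))

/-- The `C^∞` sections of `N_V`: those locally induced by `C^∞` sections of `TM`. -/
def SmoothSection [IsManifold 𝓘(ℂ, E) ω M] (ι : V → M)
    (s : Π x : V, NormalSpace (E := E) (G := G) ι x) : Prop :=
  ∀ x : V, ∃ U : Set M, IsOpen U ∧ ι x ∈ U ∧
    ∃ A : Π y : M, TangentSpace 𝓘(ℂ, E) y, SmoothFieldOn A U ∧ Induces ι A s U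

/-- The section `s` of `N_V` is holomorphic near `x`: it is induced there by a holomorphic section
of `TM`. -/
def HolomorphicNear [IsManifold 𝓘(ℂ, E) ω M] (ι : V → M)
    (s : Π x : V, NormalSpace (E := E) (G := G) ι x) (x : V) : Prop :=
  ∃ U : Set M, IsOpen U ∧ ι x ∈ U ∧
    ∃ A : Π y : M, TangentSpace 𝓘(ℂ, E) y, HolomorphicFieldOn A U ∧ Induces ι A s U

/-- `F` leaves the submanifold invariant: `F|_V ⊆ TV`. -/
def LeavesInvariant (ι : V → M) (F : Π y : M, Submodule ℂ (TangentSpace 𝓘(ℂ, E) y)) : Prop :=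
  ∀ x : V, F (ι x) ≤ tangentImage (E := E) (G := G) ι x

/-- The section `u` of `TV` is a `C^∞` section of `F_V = F|_V`. -/
def IsSectionOfRestriction [IsManifold 𝓘(ℂ, G) ω V] (ι : V → M)
    (F : Π y : M, Submodule ℂ (TangentSpace 𝓘(ℂ, E) y))
    (u : Π x : V, TangentSpace 𝓘(ℂ, G) x) : Prop :=
  SmoothFieldOn u Set.univ ∧ ∀ x : V, mfderiv 𝓘(ℂ, G) 𝓘(ℂ, E) ι x (u x) ∈ F (ι x)

/-- `A` and `B` are extensions near `x` used to compute the Camacho-Sad action of `u` on `s`: on a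
neighbourhood of `ι x`, `A` is a `C^∞` section of `F` with `A|_V = u` and `B` is a `C^∞` section of
`TM` inducing `s`. -/
def IsExtension [IsManifold 𝓘(ℂ, E) ω M] (ι : V → M)
    (F : Π y : M, Submodule ℂ (TangentSpace 𝓘(ℂ, E) y))
    (u : Π x : V, TangentSpace 𝓘(ℂ, G) x) (s : Π x : V, NormalSpace (E := E) (G := G) ι x) (x : V)
    (A B : Π y : M, TangentSpace 𝓘(ℂ, E) y) : Prop :=
  ∃ U : Set M, IsOpen U ∧ ι x ∈ U ∧ SmoothFieldOn A U ∧ SmoothFieldOn B U ∧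
    (∀ y ∈ U, A y ∈ F y) ∧
    (∀ z : V, ι z ∈ U → A (ι z) = mfderiv 𝓘(ℂ, G) 𝓘(ℂ, E) ι z (u z)) ∧
    Induces ι B s U

/-- The Camacho-Sad action `α(u, s) = π([A, B]|_V)`, where `A` and `B` extend `u` and `s`. Such
extensions exist near every point, and any of them may be chosen. -/
def action [IsManifold 𝓘(ℂ, E) ω M] (ι : V → M)
    (F : Π y : M, Submodule ℂ (TangentSpace 𝓘(ℂ, E) y))
    (u : Π x : V, TangentSpace 𝓘(ℂ, G) x) (s : Π x : V, NormalSpace (E := E) (G := G) ι x) :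
    Π x : V, NormalSpace (E := E) (G := G) ι x :=
  fun x =>
    let AB := Classical.epsilon
      fun q : (Π y : M, TangentSpace 𝓘(ℂ, E) y) × (Π y : M, TangentSpace 𝓘(ℂ, E) y) =>
        IsExtension ι F u s x q.1 q.2
    (tangentImage (E := E) (G := G) ι x).mkQ (bracket AB.1 AB.2 (ι x))

variable [IsManifold 𝓘(ℂ, E) ω M] [IsManifold 𝓘(ℂ, G) ω V]

/-- A connection `∇` for `N_V`: a `ℂ`-linear map from `C^∞` sections of `N_V` to `C^∞` one-forms
with values in `N_V`, with the Leibniz rule. `∇ s x v` is the derivative of `s` in the real tangent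
direction `v`. Only its values on `C^∞` sections matter. -/
structure NormalConnection (ι : V → M) where
  /-- the underlying map -/
  toFun : (Π x : V, NormalSpace (E := E) (G := G) ι x) →
    Π x : V, TangentSpace 𝓘(ℂ, G) x →ₗ[ℝ] NormalSpace (E := E) (G := G) ι x
  smooth : ∀ s (X : Π x : V, TangentSpace 𝓘(ℂ, G) x), SmoothSection ι s →
    SmoothFieldOn X Set.univ → SmoothSection ι (fun x => toFun s x (X x))
  map_add : ∀ s t, SmoothSection ι s → SmoothSection ι t →
    ∀ x v, toFun (fun z => s z + t z) x v = toFun s x v + toFun t x v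
  map_smul : ∀ (c : ℂ) s, SmoothSection ι s →
    ∀ x v, toFun (fun z => c • s z) x v = c • toFun s x v
  leibniz : ∀ (f : V → ℂ) s, SmoothFun (E := G) f → SmoothSection ι s →
    ∀ x v, toFun (fun z => f z • s z) x v = differential f x v • s x + f x • toFun s x v

namespace NormalConnection

variable {ι : V → M}

/-- `∇_u s` for a section `u` of `TV = T^{1,0}V`, i.e. `∇ s` evaluated on `(u - i J u) / 2`. -/
def holDeriv (D : NormalConnection (E := E) (G := G) ι) (u : Π x : V, TangentSpace 𝓘(ℂ, G) x)
    (s : Π x : V, NormalSpace (E := E) (G := G) ι x) :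
    Π x : V, NormalSpace (E := E) (G := G) ι x :=
  fun x => (1 / 2 : ℂ) • (D.toFun s x (u x) - Complex.I • D.toFun s x (Complex.I • u x))

/-- `∇` is of type `(1,0)`: for `s` holomorphic near `x`, the form `∇ s` is of type `(1,0)`, i.e.
complex linear, at `x`. -/
def IsTypeOneZero (D : NormalConnection (E := E) (G := G) ι) : Prop :=
  ∀ s, SmoothSection ι s → ∀ x, HolomorphicNear ι s x →
    ∀ v, D.toFun s x (Complex.I • v) = Complex.I • D.toFun s x v

/-- `∇` is an `F_V`-connection for `N_V`, for the Camacho-Sad action. -/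
def IsFVConnection (D : NormalConnection (E := E) (G := G) ι)
    (F : Π y : M, Submodule ℂ (TangentSpace 𝓘(ℂ, E) y)) : Prop :=
  D.IsTypeOneZero ∧ ∀ u s, IsSectionOfRestriction ι F u → SmoothSection ι s →
    ∀ x, D.holDeriv u s x = action ι F u s x

end NormalConnection

/-- A Hermitian metric on `N_V`, linear in the first variable. -/
structure HermitianMetric (ι : V → M) where
  /-- the Hermitian form on each fibre -/
  form : Π x : V, NormalSpace (E := E) (G := G) ι x →ₗ[ℂ]
    NormalSpace (E := E) (G := G) ι x →ₗ⋆[ℂ] ℂ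
  symm : ∀ x a b, form x b a = star (form x a b)
  pos : ∀ x a, a ≠ 0 → 0 < (form x a a).re
  smooth : ∀ s t, SmoothSection ι s → SmoothSection ι t →
    SmoothFun (E := G) (fun x => form x (s x) (t x))

namespace NormalConnection

variable {ι : V → M}

/-- `∇` is Hermitian: `d h(s, t) = h(∇ s, t) + h(s, ∇ t)` for some Hermitian metric `h`. -/
def IsHermitian (D : NormalConnection (E := E) (G := G) ι) : Prop :=
  ∃ h : HermitianMetric (E := E) (G := G) ι,
    ∀ s t, SmoothSection ι s → SmoothSection ι t → ∀ x v,
      differential (fun z => h.form z (s z) (t z)) x v =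
        h.form x (D.toFun s x v) (t x) + h.form x (s x) (D.toFun t x v)

/-- The curvature `K(X, Y) s = ∇_X ∇_Y s - ∇_Y ∇_X s - ∇_{[X, Y]} s` on real vector fields. -/
def curvatureOnFields (D : NormalConnection (E := E) (G := G) ι)
    (X Y : Π x : V, TangentSpace 𝓘(ℂ, G) x) (s : Π x : V, NormalSpace (E := E) (G := G) ι x) :
    Π x : V, NormalSpace (E := E) (G := G) ι x :=
  fun x => D.toFun (fun z => D.toFun s z (Y z)) x (X x)
    - D.toFun (fun z => D.toFun s z (X z)) x (Y x) - D.toFun s x (realBracket X Y x)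

/-- The curvature at a point, `K_x(v, w) ξ`, computed with any `C^∞` fields `X`, `Y` and any `C^∞`
section `s` with the values `v`, `w` and `ξ` at `x`; such extensions exist. -/
def curvature (D : NormalConnection (E := E) (G := G) ι) (x : V)
    (v w : TangentSpace 𝓘(ℂ, G) x) (ξ : NormalSpace (E := E) (G := G) ι x) :
    NormalSpace (E := E) (G := G) ι x :=
  let X := Classical.epsilon fun X : Π z : V, TangentSpace 𝓘(ℂ, G) z =>
    SmoothFieldOn X Set.univ ∧ X x = v
  let Y := Classical.epsilon fun Y : Π z : V, TangentSpace 𝓘(ℂ, G) z =>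
    SmoothFieldOn Y Set.univ ∧ Y x = w
  let s := Classical.epsilon fun s : Π z : V, NormalSpace (E := E) (G := G) ι z =>
    SmoothSection ι s ∧ s x = ξ
  D.curvatureOnFields X Y s x

/-- The curvature matrix in the frame `b` of the fibre at `x`: `K b_j = ∑ i, κ_ij b_i`. -/
def curvatureMatrix (D : NormalConnection (E := E) (G := G) ι) {x : V} {l : ℕ}
    (b : Module.Basis (Fin l) ℂ (NormalSpace (E := E) (G := G) ι x))
    (v w : TangentSpace 𝓘(ℂ, G) x) : Matrix (Fin l) (Fin l) ℂ :=
  Matrix.of fun i j => b.repr (D.curvature x v w (b j)) i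

end NormalConnection

end Normal

section Polynomials

/-- The value of a polynomial in the entries of an `l × l` matrix. -/
def evalMatrix {l : ℕ} (φ : MvPolynomial (Fin l × Fin l) ℂ) (A : Matrix (Fin l) (Fin l) ℂ) : ℂ :=
  MvPolynomial.eval (fun ij => A ij.1 ij.2) φ

/-- The polynomial `φ` on matrices is invariant under conjugation. -/
def IsInvariant {l : ℕ} (φ : MvPolynomial (Fin l × Fin l) ℂ) : Prop :=
  ∀ (g : GL (Fin l) ℂ) (A : Matrix (Fin l) (Fin l) ℂ),
    evalMatrix φ ((g : Matrix (Fin l) (Fin l) ℂ) * A * ((g⁻¹ : GL (Fin l) ℂ) : Matrix _ _ ℂ)) =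
      evalMatrix φ A

/-- The polarization of a homogeneous polynomial `φ` of degree `k`: the symmetric `k`-linear form
whose value on `(A, …, A)` is `φ(A)`. -/
def polarization {l : ℕ} (φ : MvPolynomial (Fin l × Fin l) ℂ) (k : ℕ)
    (A : Fin k → Matrix (Fin l) (Fin l) ℂ) : ℂ :=
  (k.factorial : ℂ)⁻¹ * ∑ S : Finset (Fin k), (-1) ^ (k - S.card) * evalMatrix φ (∑ i ∈ S, A i)

/-- `φ(κ)` for a matrix `κ` of two-forms on a vector space `T` and `φ` homogeneous of degree `k`,
the products of two-forms being wedge products: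
`φ(κ)(v_0, …, v_{2k-1})` is the sum over all permutations `σ` of
`2^{-k} sgn(σ) φ~(κ(v_{σ 0}, v_{σ 1}), …, κ(v_{σ (2k-2)}, v_{σ (2k-1)}))`. -/
def evalForm {T : Type*} {l : ℕ} (φ : MvPolynomial (Fin l × Fin l) ℂ) (k : ℕ)
    (κ : T → T → Matrix (Fin l) (Fin l) ℂ) (v : Fin (2 * k) → T) : ℂ :=
  ((2 : ℂ) ^ k)⁻¹ * ∑ σ : Equiv.Perm (Fin (2 * k)), ((Equiv.Perm.sign σ : ℤ) : ℂ) *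
    polarization φ k fun i =>
      κ (v (σ ⟨2 * i.1, by omega⟩)) (v (σ ⟨2 * i.1 + 1, by omega⟩))

end Polynomials

/-- The `2k`-form `φ(∇) = (i / 2π)^k φ(K)` at the point `x`, computed in the frame `b` of the fibre;
since `φ` is invariant it does not depend on the frame. -/
def NormalConnection.chernForm {E : Type*} [NormedAddCommGroup E] [NormedSpace ℂ E]
    {G : Type*} [NormedAddCommGroup G] [NormedSpace ℂ G]
    {M : Type*} [TopologicalSpace M] [ChartedSpace E M] [IsManifold 𝓘(ℂ, E) ω M]
    {V : Type*} [TopologicalSpace V] [ChartedSpace G V] [IsManifold 𝓘(ℂ, G) ω V]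
    {ι : V → M} (D : NormalConnection (E := E) (G := G) ι) {l : ℕ}
    (φ : MvPolynomial (Fin l × Fin l) ℂ) (k : ℕ) {x : V}
    (b : Module.Basis (Fin l) ℂ (NormalSpace (E := E) (G := G) ι x))
    (v : Fin (2 * k) → TangentSpace 𝓘(ℂ, G) x) : ℂ :=
  (Complex.I / (2 * Real.pi)) ^ k * evalForm φ k (D.curvatureMatrix b) v

end CamachoSad

end

/-!
The manifold `V` carries a connection `∇` on `N_V` which restricts to the Camacho-Sad action along
`F_V`, and it is Hermitian. The point is that its curvature `K` is annihilated by the vectors of `F_V`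
(`NormalConnection.curvature_eq_zero`). Once this is known, every value of `φ(K)` is a sum of products
of `k` entries `K(v, w)`, so it vanishes as soon as one argument lies in `F_V`; a `2k`-form with this
property is zero when `2k` exceeds the real codimension `2(d - p)` of `F_V` in `TV`
(`evalForm_eq_zero`).

For the vanishing of `K(v, ·)` with `v` in `F_V`, extend `v` to a local holomorphic section `u` of
`F_V`. If `s` is a holomorphic section of `N_V`, then `∇_u s` is the class of a bracket of holomorphic
fields, so it is holomorphic again. As `∇` is of type `(1,0)`, both `∇ s` and `∇ (∇_u s)` are complex
linear in the direction, and with a field `Y` constant in coordinates one gets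
`K(u, J Y) s = i K(u, Y) s`
(`NormalConnection.curvature_add_I_smul`). On the other hand `K(u, Y)` and `K(u, J Y)` are
skew-Hermitian for the metric preserved by `∇` (`NormalConnection.curvature_skew`), and `K(u, Y)` is
`-i` times the latter; so it is Hermitian as well as skew-Hermitian, hence zero.

Two facts are needed to make sense of this pointwise. The curvature at a point and the action do not
depend on the extensions used to compute them. For the curvature this is the usual tensoriality
(`NormalConnection.curvature_eq`), obtained from the locality of `∇` and smooth local frames. For the
action (`action_eq`), work in a chart in which `V` is a slice `G × {0}` of `G × C`: two extensions of a
section of `F_V` to `F` differ by a section of `F` vanishing on `V`, whose derivatives at a point of `V`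
remain in `F` (`fderiv_mem_span`), hence are tangent to `V` and do not contribute to the normal
component of the bracket (`coordBracket_normal_eq`).
-/

noncomputable section

set_option linter.unusedSectionVars false

namespace CamachoSad

open Set Filter Topology IsManifold VectorField

/-! ### Vector fields in charts -/

section Coordinates

variable {𝕜 : Type*} [RCLike 𝕜] {E : Type*} [NormedAddCommGroup E] [NormedSpace 𝕜 E]
  {M : Type*} [TopologicalSpace M] [ChartedSpace E M]

variable (𝕜) in
/-- The coordinate expression of a vector field in the chart `c`. Only its values on the target of
`c` are meaningful. -/
def coordField (c : OpenPartialHomeomorph M E) (A : Π y : M, TangentSpace 𝓘(𝕜, E) y) : E → E :=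
  fun a => mfderiv 𝓘(𝕜, E) 𝓘(𝕜, E) c (c.symm a) (A (c.symm a))

variable (𝕜) in
/-- The vector field whose coordinate expression in the chart `c` is `a`. -/
def fieldOfCoord (c : OpenPartialHomeomorph M E) (a : E → E) : Π y : M, TangentSpace 𝓘(𝕜, E) y :=
  fun y => mfderiv 𝓘(𝕜, E) 𝓘(𝕜, E) c.symm (c y) (a (c y))

variable {c : OpenPartialHomeomorph M E} {n : ℕ∞ω}

lemma mdifferentiable_chart_of_mem (hc : c ∈ maximalAtlas 𝓘(𝕜, E) n M) (hn : n ≠ 0) :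
    c.MDifferentiable 𝓘(𝕜, E) 𝓘(𝕜, E) :=
  ⟨(contMDiffOn_of_mem_maximalAtlas hc).mdifferentiableOn hn,
    (contMDiffOn_symm_of_mem_maximalAtlas hc).mdifferentiableOn hn⟩

lemma mfderiv_symm_mfderiv (hc : c ∈ maximalAtlas 𝓘(𝕜, E) n M) (hn : n ≠ 0) {y : M}
    (hy : y ∈ c.source) (v : TangentSpace 𝓘(𝕜, E) y) :
    mfderiv 𝓘(𝕜, E) 𝓘(𝕜, E) c.symm (c y) (mfderiv 𝓘(𝕜, E) 𝓘(𝕜, E) c y v) = v :=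
  DFunLike.congr_fun ((mdifferentiable_chart_of_mem hc hn).symm_comp_deriv hy) v

lemma mfderiv_mfderiv_symm (hc : c ∈ maximalAtlas 𝓘(𝕜, E) n M) (hn : n ≠ 0) {a : E}
    (ha : a ∈ c.target) (v : TangentSpace 𝓘(𝕜, E) a) :
    mfderiv 𝓘(𝕜, E) 𝓘(𝕜, E) c (c.symm a) (mfderiv 𝓘(𝕜, E) 𝓘(𝕜, E) c.symm a v) = v :=
  DFunLike.congr_fun ((mdifferentiable_chart_of_mem hc hn).comp_symm_deriv ha) v

lemma coordField_apply (A : Π y : M, TangentSpace 𝓘(𝕜, E) y) {y : M} (hy : y ∈ c.source) :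
    coordField 𝕜 c A (c y) = mfderiv 𝓘(𝕜, E) 𝓘(𝕜, E) c y (A y) := by
  simp only [coordField]
  rw [c.left_inv hy]

lemma coordField_fieldOfCoord (hc : c ∈ maximalAtlas 𝓘(𝕜, E) n M) (hn : n ≠ 0) (a : E → E)
    {w : E} (hw : w ∈ c.target) : coordField 𝕜 c (fieldOfCoord 𝕜 c a) w = a w := by
  simp only [coordField, fieldOfCoord]
  rw [c.right_inv hw]
  exact mfderiv_mfderiv_symm hc hn hw (a w)

lemma fieldOfCoord_coordField (hc : c ∈ maximalAtlas 𝓘(𝕜, E) n M) (hn : n ≠ 0)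
    (A : Π y : M, TangentSpace 𝓘(𝕜, E) y) {y : M} (hy : y ∈ c.source) :
    fieldOfCoord 𝕜 c (coordField 𝕜 c A) y = A y := by
  simp only [fieldOfCoord]
  rw [coordField_apply A hy]
  exact mfderiv_symm_mfderiv hc hn hy (A y)

lemma mpullback_symm_eq_coordField (hc : c ∈ maximalAtlas 𝓘(𝕜, E) n M) (hn : n ≠ 0)
    (A : Π y : M, TangentSpace 𝓘(𝕜, E) y) {w : E} (hw : w ∈ c.target) :
    mpullback 𝓘(𝕜, E) 𝓘(𝕜, E) c.symm A w = coordField 𝕜 c A w := by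
  have h : ContinuousLinearMap.inverse (mfderiv 𝓘(𝕜, E) 𝓘(𝕜, E) c.symm w) =
      mfderiv 𝓘(𝕜, E) 𝓘(𝕜, E) c (c.symm w) :=
    ContinuousLinearMap.inverse_eq
      (ContinuousLinearMap.ext fun v => by
        have := mfderiv_symm_mfderiv hc hn (c.map_target hw) v
        rwa [c.right_inv hw] at this)
      ((mdifferentiable_chart_of_mem hc hn).comp_symm_deriv hw)
  exact congrArg (fun L : E →L[𝕜] E => L (A (c.symm w))) h

lemma mpullback_eq_fieldOfCoord (hc : c ∈ maximalAtlas 𝓘(𝕜, E) n M) (hn : n ≠ 0)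
    (a : E → E) {y : M} (hy : y ∈ c.source) :
    mpullback 𝓘(𝕜, E) 𝓘(𝕜, E) c a y = fieldOfCoord 𝕜 c a y := by
  have h : ContinuousLinearMap.inverse (mfderiv 𝓘(𝕜, E) 𝓘(𝕜, E) c y) =
      mfderiv 𝓘(𝕜, E) 𝓘(𝕜, E) c.symm (c y) :=
    ContinuousLinearMap.inverse_eq
      (ContinuousLinearMap.ext fun v => by
        have := mfderiv_mfderiv_symm hc hn (c.map_source hy) v
        rwa [c.left_inv hy] at this)
      ((mdifferentiable_chart_of_mem hc hn).symm_comp_deriv hy)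
  exact congrArg (fun L : E →L[𝕜] E => L (a (c y))) h

lemma isInvertible_mfderiv_chart (hc : c ∈ maximalAtlas 𝓘(𝕜, E) n M) (hn : n ≠ 0) {y : M}
    (hy : y ∈ c.source) : (mfderiv 𝓘(𝕜, E) 𝓘(𝕜, E) c y).IsInvertible :=
  ⟨(mdifferentiable_chart_of_mem hc hn).mfderiv hy, rfl⟩

lemma isInvertible_mfderiv_chart_symm (hc : c ∈ maximalAtlas 𝓘(𝕜, E) n M) (hn : n ≠ 0) {w : E}
    (hw : w ∈ c.target) : (mfderiv 𝓘(𝕜, E) 𝓘(𝕜, E) c.symm w).IsInvertible :=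
  ⟨(mdifferentiable_chart_of_mem hc hn).symm.mfderiv hw, rfl⟩

lemma coordField_eventuallyEq (hc : c ∈ maximalAtlas 𝓘(𝕜, E) n M) (hn : n ≠ 0)
    (A : Π y : M, TangentSpace 𝓘(𝕜, E) y) {w : E} (hw : w ∈ c.target) :
    coordField 𝕜 c A =ᶠ[𝓝 w] mpullback 𝓘(𝕜, E) 𝓘(𝕜, E) c.symm A := by
  filter_upwards [c.open_target.mem_nhds hw] with w' hw'
  exact (mpullback_symm_eq_coordField hc hn A hw').symm

variable [CompleteSpace E] [IsManifold 𝓘(𝕜, E) ω M]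

/-- A vector field is of class `C^m` if and only if its coordinate expression is. -/
lemma contMDiffAt_field_iff (hc : c ∈ maximalAtlas 𝓘(𝕜, E) ω M) {m : ℕ∞ω}
    (A : Π y : M, TangentSpace 𝓘(𝕜, E) y) {y : M} (hy : y ∈ c.source) :
    ContMDiffAt 𝓘(𝕜, E) 𝓘(𝕜, E).tangent m
      (fun y => (⟨y, A y⟩ : TangentBundle 𝓘(𝕜, E) M)) y ↔
    ContDiffAt 𝕜 m (coordField 𝕜 c A) (c y) := by
  have : IsManifold 𝓘(𝕜, E) 1 M := .of_le (n := ω) le_top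
  have hcy := c.map_source hy
  constructor
  · intro h
    have h1 := ContMDiffAt.mpullback_vectorField_preimage (I := 𝓘(𝕜, E)) (f := c.symm) (n := ω)
      (x₀ := c y) (V := A) (m := m) (by rwa [c.left_inv hy])
      (contMDiffAt_symm_of_mem_maximalAtlas hc hcy)
      (isInvertible_mfderiv_chart_symm hc (by simp) hcy) le_top
    have h2 := contMDiffAt_vectorSpace_iff_contDiffAt.1 h1
    exact h2.congr_of_eventuallyEq (coordField_eventuallyEq hc (by simp) A hcy)
  · intro h
    have h2 := contMDiffAt_vectorSpace_iff_contDiffAt.2 h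
    have h1 := ContMDiffAt.mpullback_vectorField_preimage (I := 𝓘(𝕜, E)) (f := c) (n := ω)
      (x₀ := y) (V := coordField 𝕜 c A) (m := m) h2
      (contMDiffAt_of_mem_maximalAtlas hc hy)
      (isInvertible_mfderiv_chart hc (by simp) hy) le_top
    refine h1.congr_of_eventuallyEq ?_
    filter_upwards [c.open_source.mem_nhds hy] with z hz
    rw [mpullback_eq_fieldOfCoord hc (by simp) _ hz, fieldOfCoord_coordField hc (by simp) _ hz]

lemma coordField_mlieBracket (hc : c ∈ maximalAtlas 𝓘(𝕜, E) ω M)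
    {A B : Π y : M, TangentSpace 𝓘(𝕜, E) y} {y : M} (hy : y ∈ c.source)
    (hA : MDifferentiableAt 𝓘(𝕜, E) 𝓘(𝕜, E).tangent
      (fun y => (⟨y, A y⟩ : TangentBundle 𝓘(𝕜, E) M)) y)
    (hB : MDifferentiableAt 𝓘(𝕜, E) 𝓘(𝕜, E).tangent
      (fun y => (⟨y, B y⟩ : TangentBundle 𝓘(𝕜, E) M)) y) :
    mfderiv 𝓘(𝕜, E) 𝓘(𝕜, E) c y (mlieBracket 𝓘(𝕜, E) A B y) =
      lieBracket 𝕜 (coordField 𝕜 c A) (coordField 𝕜 c B) (c y) := by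
  have : IsManifold 𝓘(𝕜, E) (minSmoothness 𝕜 3) M := .of_le (n := ω) le_top
  have hcy := c.map_source hy
  have h := mpullback_mlieBracket (I := 𝓘(𝕜, E)) (I' := 𝓘(𝕜, E)) (f := c.symm) (n := ω)
    (x₀ := c y) (V := A) (W := B) (by rwa [c.left_inv hy]) (by rwa [c.left_inv hy])
    (contMDiffAt_symm_of_mem_maximalAtlas hc hcy) le_top
  rw [mpullback_symm_eq_coordField hc (by simp) _ hcy, coordField_apply _ hy] at h
  refine h.trans (((coordField_eventuallyEq hc (by simp) A hcy).symm.mlieBracket_vectorField_eq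
    (coordField_eventuallyEq hc (by simp) B hcy).symm).trans ?_)
  exact congrFun ((mlieBracketWithin_univ (I := 𝓘(𝕜, E))).symm.trans
    (mlieBracketWithin_eq_lieBracketWithin.trans lieBracketWithin_univ)) (c y)

end Coordinates

section RealComplex

variable {E : Type*} [NormedAddCommGroup E] [NormedSpace ℂ E]
  {M : Type*} [TopologicalSpace M] [ChartedSpace E M]
  {E' : Type*} [NormedAddCommGroup E'] [NormedSpace ℂ E']
  {M' : Type*} [TopologicalSpace M'] [ChartedSpace E' M']

lemma mfderiv_real {f : M → M'} {x : M} (h : MDifferentiableAt 𝓘(ℂ, E) 𝓘(ℂ, E') f x)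
    (v : TangentSpace 𝓘(ℂ, E) x) :
    mfderiv 𝓘(ℝ, E) 𝓘(ℝ, E') f x v = mfderiv 𝓘(ℂ, E) 𝓘(ℂ, E') f x v := by
  have h1 := h.hasMFDerivAt
  let L : E →L[ℂ] E' := mfderiv 𝓘(ℂ, E) 𝓘(ℂ, E') f x
  have h2 : HasMFDerivAt 𝓘(ℝ, E) 𝓘(ℝ, E') f x (L.restrictScalars ℝ) :=
    ⟨h1.1, HasFDerivWithinAt.restrictScalars ℝ h1.2⟩
  exact congrArg (fun L : E →L[ℝ] E' => L v) h2.mfderiv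

lemma contDiffGroupoid_real {n : ℕ∞ω} {f : OpenPartialHomeomorph E E}
    (hf : f ∈ contDiffGroupoid n 𝓘(ℂ, E)) : f ∈ contDiffGroupoid n 𝓘(ℝ, E) := by
  rw [contDiffGroupoid, mem_groupoid_of_pregroupoid] at hf ⊢
  exact ⟨(show ContDiffOn ℂ n _ _ from hf.1).restrict_scalars ℝ,
    (show ContDiffOn ℂ n _ _ from hf.2).restrict_scalars ℝ⟩

lemma mem_maximalAtlas_real {n : ℕ∞ω} {c : OpenPartialHomeomorph M E}
    (hc : c ∈ maximalAtlas 𝓘(ℂ, E) n M) : c ∈ maximalAtlas 𝓘(ℝ, E) n M :=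
  _root_.mem_maximalAtlas_iff.2 fun c' hc' =>
    ⟨contDiffGroupoid_real (_root_.mem_maximalAtlas_iff.1 hc c' hc').1,
      contDiffGroupoid_real (_root_.mem_maximalAtlas_iff.1 hc c' hc').2⟩

lemma coordField_realField {n : ℕ∞ω} {c : OpenPartialHomeomorph M E}
    (hc : c ∈ maximalAtlas 𝓘(ℂ, E) n M) (hn : n ≠ 0)
    (A : Π y : M, TangentSpace 𝓘(ℂ, E) y) {w : E} (hw : w ∈ c.target) :
    coordField ℝ c (realField A) w = coordField ℂ c A w :=
  mfderiv_real ((mdifferentiable_chart_of_mem hc hn).mdifferentiableAt (c.map_target hw)) _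

/-- The field `A` is of real class `C^∞` at `y`. -/
def SmoothFieldAt [IsManifold 𝓘(ℂ, E) ω M] (A : Π y : M, TangentSpace 𝓘(ℂ, E) y) (y : M) : Prop :=
  ContMDiffAt 𝓘(ℝ, E) 𝓘(ℝ, E).tangent ∞
    (fun y => (⟨y, realField A y⟩ : TangentBundle 𝓘(ℝ, E) M)) y

/-- The field `A` is holomorphic at `y`. -/
def HolomorphicFieldAt [IsManifold 𝓘(ℂ, E) ω M] (A : Π y : M, TangentSpace 𝓘(ℂ, E) y)
    (y : M) : Prop :=
  ContMDiffAt 𝓘(ℂ, E) 𝓘(ℂ, E).tangent ω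
    (fun y => (⟨y, A y⟩ : TangentBundle 𝓘(ℂ, E) M)) y

lemma coordField_eventuallyEq_of {c : OpenPartialHomeomorph M E}
    {A B : Π y : M, TangentSpace 𝓘(ℂ, E) y} {y : M} (hy : y ∈ c.source) (hAB : ∀ᶠ z in 𝓝 y, B z = A z) :
    coordField ℂ c B =ᶠ[𝓝 (c y)] coordField ℂ c A := by
  have := (c.continuousAt_symm (c.map_source hy))
  rw [ContinuousAt, c.left_inv hy] at this
  filter_upwards [this.eventually hAB] with w hw
  exact congrArg (mfderiv 𝓘(ℂ, E) 𝓘(ℂ, E) c (c.symm w) : E → E) hw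

variable [IsManifold 𝓘(ℂ, E) ω M]

lemma smoothFieldOn_iff {A : Π y : M, TangentSpace 𝓘(ℂ, E) y} {U : Set M} (hU : IsOpen U) :
    SmoothFieldOn A U ↔ ∀ y ∈ U, SmoothFieldAt A y :=
  ⟨fun h _ hy => h.contMDiffAt (hU.mem_nhds hy), fun h y hy => (h y hy).contMDiffWithinAt⟩

lemma holomorphicFieldOn_iff {A : Π y : M, TangentSpace 𝓘(ℂ, E) y} {U : Set M} (hU : IsOpen U) :
    HolomorphicFieldOn A U ↔ ∀ y ∈ U, HolomorphicFieldAt A y :=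
  ⟨fun h _ hy => h.contMDiffAt (hU.mem_nhds hy), fun h y hy => (h y hy).contMDiffWithinAt⟩

lemma SmoothFieldAt.congr {A B : Π y : M, TangentSpace 𝓘(ℂ, E) y} {y : M}
    (h : SmoothFieldAt A y) (hAB : ∀ᶠ z in 𝓝 y, B z = A z) : SmoothFieldAt B y :=
  ContMDiffAt.congr_of_eventuallyEq h (hAB.mono fun z hz => by simp [realField, hz])

variable [CompleteSpace E] {c : OpenPartialHomeomorph M E}

lemma smoothFieldAt_iff (hc : c ∈ maximalAtlas 𝓘(ℂ, E) ω M)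
    {A : Π y : M, TangentSpace 𝓘(ℂ, E) y} {y : M} (hy : y ∈ c.source) :
    SmoothFieldAt A y ↔ ContDiffAt ℝ ∞ (coordField ℂ c A) (c y) := by
  rw [SmoothFieldAt, contMDiffAt_field_iff (mem_maximalAtlas_real hc) _ hy]
  have h : coordField ℝ c (realField A) =ᶠ[𝓝 (c y)] coordField ℂ c A := by
    filter_upwards [c.open_target.mem_nhds (c.map_source hy)] with w hw
    exact coordField_realField hc (by simp) A hw
  exact ⟨fun h' => h'.congr_of_eventuallyEq h.symm, fun h' => h'.congr_of_eventuallyEq h⟩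

lemma holomorphicFieldAt_iff (hc : c ∈ maximalAtlas 𝓘(ℂ, E) ω M)
    {A : Π y : M, TangentSpace 𝓘(ℂ, E) y} {y : M} (hy : y ∈ c.source) :
    HolomorphicFieldAt A y ↔ ContDiffAt ℂ ω (coordField ℂ c A) (c y) :=
  contMDiffAt_field_iff hc _ hy

lemma HolomorphicFieldAt.smoothFieldAt {A : Π y : M, TangentSpace 𝓘(ℂ, E) y} {y : M}
    (h : HolomorphicFieldAt A y) : SmoothFieldAt A y := by
  have hc := chart_mem_maximalAtlas (I := 𝓘(ℂ, E)) (n := ω) y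
  have hy := mem_chart_source E y
  exact (smoothFieldAt_iff hc hy).2
    ((((holomorphicFieldAt_iff hc hy).1 h).restrict_scalars ℝ).of_le le_top)

lemma coordField_realBracket (hc : c ∈ maximalAtlas 𝓘(ℂ, E) ω M)
    {A B : Π y : M, TangentSpace 𝓘(ℂ, E) y} {y : M} (hy : y ∈ c.source)
    (hA : SmoothFieldAt A y) (hB : SmoothFieldAt B y) :
    coordField ℂ c (realBracket A B) (c y) =
      lieBracket ℝ (coordField ℂ c A) (coordField ℂ c B) (c y) := by
  have h := coordField_mlieBracket (mem_maximalAtlas_real hc) hy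
    (ContMDiffAt.mdifferentiableAt hA (by simp)) (ContMDiffAt.mdifferentiableAt hB (by simp))
  rw [coordField_apply _ hy]
  have e (C : Π y : M, TangentSpace 𝓘(ℂ, E) y) :
      coordField ℝ c (realField C) =ᶠ[𝓝 (c y)] coordField ℂ c C := by
    filter_upwards [c.open_target.mem_nhds (c.map_source hy)] with w hw
    exact coordField_realField hc (by simp) C hw
  refine (mfderiv_real ((mdifferentiable_chart_of_mem hc (by simp)).mdifferentiableAt hy)
    (realBracket A B y)).symm.trans (h.trans ?_)
  exact (e A).lieBracket_vectorField_eq (e B)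

/-- The coordinate expression of the bracket of two `C^∞` sections of `T^{1,0}`. -/
def coordBracket {E : Type*} [NormedAddCommGroup E] [NormedSpace ℂ E] (a b : E → E) : E → E :=
  fun w => (1 / 2 : ℂ) • (lieBracket ℝ a b w -
    lieBracket ℝ (fun z => Complex.I • a z) (fun z => Complex.I • b z) w)

omit [IsManifold 𝓘(ℂ, E) ω M] [CompleteSpace E] in
lemma coordField_smul (f : M → ℂ) (A : Π y : M, TangentSpace 𝓘(ℂ, E) y) :
    coordField ℂ c (fun y => f y • A y) = fun w => f (c.symm w) • coordField ℂ c A w :=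
  funext fun w => map_smul (mfderiv 𝓘(ℂ, E) 𝓘(ℂ, E) c (c.symm w)) (f (c.symm w)) (A (c.symm w))

omit [IsManifold 𝓘(ℂ, E) ω M] [CompleteSpace E] in
lemma coordField_add (A B : Π y : M, TangentSpace 𝓘(ℂ, E) y) :
    coordField ℂ c (fun y => A y + B y) = fun w => coordField ℂ c A w + coordField ℂ c B w :=
  funext fun w => map_add (mfderiv 𝓘(ℂ, E) 𝓘(ℂ, E) c (c.symm w)) (A (c.symm w)) (B (c.symm w))

omit [IsManifold 𝓘(ℂ, E) ω M] [CompleteSpace E] in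
lemma contMDiffAt_coord_iff [IsManifold 𝓘(ℂ, E) ω M] {F : Type*} [NormedAddCommGroup F]
    [NormedSpace ℝ F] (hc : c ∈ maximalAtlas 𝓘(ℂ, E) ω M) {f : M → F} {y : M} (hy : y ∈ c.source)
    {m : ℕ∞ω} :
    ContMDiffAt 𝓘(ℝ, E) 𝓘(ℝ, F) m f y ↔ ContDiffAt ℝ m (f ∘ c.symm) (c y) := by
  have hc' := mem_maximalAtlas_real hc
  have h1 := contMDiffAt_of_mem_maximalAtlas hc' hy
  have h2 := contMDiffAt_symm_of_mem_maximalAtlas hc' (c.map_source hy)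
  constructor
  · intro h
    exact contMDiffAt_iff_contDiffAt.1 (ContMDiffAt.comp (c y) (by rwa [c.left_inv hy])
      (h2.of_le le_top))
  · intro h
    refine ((contMDiffAt_iff_contDiffAt.2 h).comp y (h1.of_le le_top)).congr_of_eventuallyEq ?_
    filter_upwards [c.open_source.mem_nhds hy] with z hz
    simp [c.left_inv hz]

omit [CompleteSpace E] in
lemma differential_eq (hc : c ∈ maximalAtlas 𝓘(ℂ, E) ω M) {f : M → ℂ} {y : M} (hy : y ∈ c.source)
    (hf : ContMDiffAt 𝓘(ℝ, E) 𝓘(ℝ, ℂ) ∞ f y) (v : TangentSpace 𝓘(ℂ, E) y) :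
    differential f y v = fderiv ℝ (f ∘ c.symm) (c y) (mfderiv 𝓘(ℂ, E) 𝓘(ℂ, E) c y v) := by
  have hc' := mem_maximalAtlas_real hc
  have h1 := (contMDiffAt_of_mem_maximalAtlas hc' hy).mdifferentiableAt (by simp)
  have h3 : f =ᶠ[𝓝 y] (f ∘ c.symm) ∘ c := by
    filter_upwards [c.open_source.mem_nhds hy] with z hz
    simp [c.left_inv hz]
  have h4 := h3.mfderiv_eq (I := 𝓘(ℝ, E)) (I' := 𝓘(ℝ, ℂ))
  have h2 : MDifferentiableAt 𝓘(ℝ, E) 𝓘(ℝ, ℂ) (f ∘ c.symm) (c y) :=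
    (contMDiffAt_iff_contDiffAt.2 ((contMDiffAt_coord_iff hc hy).1 hf)).mdifferentiableAt (by simp)
  have h5 := mfderiv_comp y h2 h1
  have h6 := (mfderiv_eq_fderiv (𝕜 := ℝ) (f := f ∘ c.symm) (x := c y))
  have h7 := mfderiv_real ((mdifferentiable_chart_of_mem hc (by simp)).mdifferentiableAt hy) v
  exact (congrArg (fun L : E →L[ℝ] ℂ => L v) (h4.trans h5)).trans
    ((congrArg (fun L : E →L[ℝ] ℂ => L (mfderiv 𝓘(ℝ, E) 𝓘(ℝ, E) c y v)) h6).trans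
    (congrArg (fun w : E => fderiv ℝ (f ∘ c.symm) (c y) w) h7))

lemma SmoothFieldAt.smul {f : M → ℂ} {A : Π y : M, TangentSpace 𝓘(ℂ, E) y} {y : M}
    (hf : ContMDiffAt 𝓘(ℝ, E) 𝓘(ℝ, ℂ) ∞ f y) (hA : SmoothFieldAt A y) :
    SmoothFieldAt (fun z => f z • A z) y := by
  have hc := chart_mem_maximalAtlas (I := 𝓘(ℂ, E)) (n := ω) y
  have hy := mem_chart_source E y
  rw [smoothFieldAt_iff hc hy] at hA ⊢
  rw [coordField_smul]
  exact ((contMDiffAt_coord_iff hc hy).1 hf).smul hA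

lemma SmoothFieldAt.add {A B : Π y : M, TangentSpace 𝓘(ℂ, E) y} {y : M}
    (hA : SmoothFieldAt A y) (hB : SmoothFieldAt B y) :
    SmoothFieldAt (fun z => A z + B z) y := by
  have hc := chart_mem_maximalAtlas (I := 𝓘(ℂ, E)) (n := ω) y
  have hy := mem_chart_source E y
  rw [smoothFieldAt_iff hc hy] at hA hB ⊢
  rw [coordField_add]
  exact hA.add hB

lemma coordField_bracket (hc : c ∈ maximalAtlas 𝓘(ℂ, E) ω M)
    {A B : Π y : M, TangentSpace 𝓘(ℂ, E) y} {y : M} (hy : y ∈ c.source)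
    (hA : SmoothFieldAt A y) (hB : SmoothFieldAt B y) :
    coordField ℂ c (bracket A B) (c y) = coordBracket (coordField ℂ c A) (coordField ℂ c B) (c y) := by
  have hI : ContMDiffAt 𝓘(ℝ, E) 𝓘(ℝ, ℂ) ∞ (fun _ : M => Complex.I) y := contMDiffAt_const
  have e1 := coordField_realBracket hc hy hA hB
  have e2 := coordField_realBracket hc hy (hA.smul hI) (hB.smul hI)
  rw [coordField_apply _ hy] at e1 e2 ⊢
  rw [coordField_smul, coordField_smul] at e2
  simp only [coordBracket, ← e1, ← e2]
  let L : E →L[ℂ] E := mfderiv 𝓘(ℂ, E) 𝓘(ℂ, E) c y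
  let p : E := realBracket A B y
  let q : E := realBracket (fun z => Complex.I • A z) (fun z => Complex.I • B z) y
  change L ((1 / 2 : ℂ) • (p - q)) = (1 / 2 : ℂ) • (L p - L q)
  rw [map_smul, map_sub]

omit [IsManifold 𝓘(ℂ, E) ω M] [CompleteSpace E] in
lemma lieBracket_restrictScalars {a b : E → E} {w : E} (ha : DifferentiableAt ℂ a w)
    (hb : DifferentiableAt ℂ b w) : lieBracket ℝ a b w = lieBracket ℂ a b w := by
  simp only [lieBracket, ha.fderiv_restrictScalars ℝ, hb.fderiv_restrictScalars ℝ]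
  rfl

omit [IsManifold 𝓘(ℂ, E) ω M] [CompleteSpace E] in
lemma coordBracket_of_holomorphic {a b : E → E} {w : E} (ha : DifferentiableAt ℂ a w)
    (hb : DifferentiableAt ℂ b w) : coordBracket a b w = lieBracket ℂ a b w := by
  have h := lieBracket_restrictScalars (ha.const_smul Complex.I) (hb.const_smul Complex.I)
  have h' := lieBracket_restrictScalars ha hb
  have e : lieBracket ℂ (Complex.I • a) (Complex.I • b) w = - lieBracket ℂ a b w := by
    rw [lieBracket_const_smul_left (ha), lieBracket_const_smul_right hb, smul_smul]
    simp
  simp only [coordBracket]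
  rw [h']
  change (1 / 2 : ℂ) • (_ - lieBracket ℝ (Complex.I • a) (Complex.I • b) w) = _
  rw [show lieBracket ℝ (Complex.I • a) (Complex.I • b) w = _ from h, e, sub_neg_eq_add, ← two_smul ℂ,
    smul_smul]
  norm_num

/-- On holomorphic fields the bracket of sections of `T^{1,0}` is the complex Lie bracket in
coordinates, whence it is holomorphic. -/
lemma HolomorphicFieldAt.bracket {A B : Π y : M, TangentSpace 𝓘(ℂ, E) y} {U : Set M}
    (hU : IsOpen U) (hA : ∀ y ∈ U, HolomorphicFieldAt A y) (hB : ∀ y ∈ U, HolomorphicFieldAt B y)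
    {y : M} (hyU : y ∈ U) : HolomorphicFieldAt (bracket A B) y := by
  have hc := chart_mem_maximalAtlas (I := 𝓘(ℂ, E)) (n := ω) y
  have hy := mem_chart_source E y
  set c := chartAt E y
  rw [holomorphicFieldAt_iff hc hy]
  have ha := (holomorphicFieldAt_iff hc hy).1 (hA y hyU)
  have hb := (holomorphicFieldAt_iff hc hy).1 (hB y hyU)
  have h : ContDiffAt ℂ ω (lieBracket ℂ (coordField ℂ c A) (coordField ℂ c B)) (c y) :=
    ((hb.fderiv_right le_top).clm_apply ha).sub ((ha.fderiv_right le_top).clm_apply hb)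
  refine h.congr_of_eventuallyEq ?_
  have := (c.continuousAt_symm (c.map_source hy))
  rw [ContinuousAt, c.left_inv hy] at this
  filter_upwards [this.eventually (hU.mem_nhds hyU), c.open_target.mem_nhds (c.map_source hy)]
    with w hw hw'
  have hw'' := c.map_target hw'
  have h1 := coordField_bracket hc hw'' (hA _ hw).smoothFieldAt (hB _ hw).smoothFieldAt
  rw [c.right_inv hw'] at h1
  rw [h1]
  have h2 := ((holomorphicFieldAt_iff hc hw'').1 (hA _ hw)).differentiableAt (by simp)
  have h3 := ((holomorphicFieldAt_iff hc hw'').1 (hB _ hw)).differentiableAt (by simp)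
  rw [c.right_inv hw'] at h2 h3
  exact coordBracket_of_holomorphic h2 h3

end RealComplex

/-! ### Calculus in coordinates -/

section Calculus

variable {E : Type*} [NormedAddCommGroup E] [NormedSpace ℂ E]
  {G : Type*} [NormedAddCommGroup G] [NormedSpace ℂ G]
  {C : Type*} [NormedAddCommGroup C] [NormedSpace ℂ C]

/-- The directional derivatives along two vector fields commute up to the Lie bracket. -/
lemma fderiv_fderiv_sub_fderiv_fderiv {f : E → ℂ} {x y : E → E} {w : E} (hf : ContDiffAt ℝ 2 f w)
    (hx : DifferentiableAt ℝ x w) (hy : DifferentiableAt ℝ y w) :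
    fderiv ℝ (fun z => fderiv ℝ f z (y z)) w (x w) - fderiv ℝ (fun z => fderiv ℝ f z (x z)) w (y w) =
      fderiv ℝ f w (lieBracket ℝ x y w) := by
  have h := (hf.fderiv_right (m := 1) (by norm_num)).differentiableAt (by simp)
  rw [fderiv_clm_apply h hy, fderiv_clm_apply h hx]
  have hs := (hf.isSymmSndFDerivAt (by simp)).eq (x w) (y w)
  simp [lieBracket, hs]

/-- A map with values in a continuous family of subspaces spanned by a frame, vanishing at `w`, has
its derivative at `w` valued in the subspace at `w`: its difference quotients at `w` lie in the
neighbouring subspaces, and are fixed by projections depending continuously on the point. -/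
lemma fderiv_mem_span [FiniteDimensional ℂ E] {p : ℕ} {A : Fin p → E → E} {w : E}
    (hA : ∀ i, ContinuousAt (A i) w) (hind : LinearIndependent ℂ fun i => A i w) {d : E → E}
    (hd : DifferentiableAt ℝ d w) (hd0 : d w = 0)
    (hmem : ∀ᶠ z in 𝓝 w, d z ∈ Submodule.span ℂ (range fun i => A i z)) (v : E) :
    fderiv ℝ d w v ∈ Submodule.span ℂ (range fun i => A i w) := by
  let T : E → ((Fin p → ℂ) →L[ℂ] E) := fun z =>
    ∑ i, (ContinuousLinearMap.proj (R := ℂ) (φ := fun _ : Fin p => ℂ) i).smulRight (A i z)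
  have hTapply (z : E) (c : Fin p → ℂ) : T z c = ∑ i, c i • A i z := by simp [T]
  have hTmem (z : E) (y : E) :
      y ∈ Submodule.span ℂ (range fun i => A i z) ↔ ∃ c, T z c = y := by
    simp only [hTapply, Submodule.mem_span_range_iff_exists_fun]
  have hT : ContinuousAt T w := by
    refine tendsto_finsetSum _ fun i _ => ?_
    exact ((ContinuousLinearMap.smulRightL ℂ (Fin p → ℂ) E
      (ContinuousLinearMap.proj (R := ℂ) (φ := fun _ : Fin p => ℂ) i)).continuous.continuousAt).comp
      (hA i)
  have hinj : LinearMap.ker (T w).toLinearMap = ⊥ := by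
    rw [LinearMap.ker_eq_bot']
    intro c hc
    have hc' : ∑ i, c i • A i w = 0 := by rw [← hTapply]; exact hc
    exact funext (Fintype.linearIndependent_iff.1 hind c hc')
  obtain ⟨L₀, hL₀⟩ := LinearMap.exists_leftInverse_of_injective _ hinj
  let L : E →L[ℂ] (Fin p → ℂ) := L₀.toContinuousLinearMap
  have hL : L ∘L T w = (ContinuousLinearEquiv.refl ℂ (Fin p → ℂ) : _ →L[ℂ] _) := by
    ext1 c; exact congrArg (fun l : (Fin p → ℂ) →ₗ[ℂ] (Fin p → ℂ) => l c) hL₀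
  let S : E → ((Fin p → ℂ) →L[ℂ] (Fin p → ℂ)) := fun z => L ∘L T z
  have hS : ContinuousAt S w :=
    ((ContinuousLinearMap.compL ℂ (Fin p → ℂ) E (Fin p → ℂ) L).continuous.continuousAt).comp hT
  have hSinv : ContinuousAt (fun z => (S z).inverse) w := by
    have h := (contDiffAt_map_inverse (𝕜 := ℂ) (n := 0)
      (ContinuousLinearEquiv.refl ℂ (Fin p → ℂ))).continuousAt
    rw [← hL] at h
    exact ContinuousAt.comp (f := S) h hS
  have hSev : ∀ᶠ z in 𝓝 w, (S z).IsInvertible := by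
    have h := ContinuousLinearEquiv.nhds (ContinuousLinearEquiv.refl ℂ (Fin p → ℂ))
    rw [← hL] at h
    filter_upwards [hS h] with z hz using hz
  -- `R z` is a projection onto the span at `z`, depending continuously on `z`
  let R : E → (E →L[ℂ] E) := fun z => (T z ∘L (S z).inverse) ∘L L
  have hR : ContinuousAt R w := (hT.clm_comp hSinv).clm_comp continuousAt_const
  have hRd : ∀ᶠ z in 𝓝 w, R z (d z) = d z := by
    filter_upwards [hSev, hmem] with z hz hz'
    obtain ⟨c, hc⟩ := (hTmem z _).1 hz'
    have h1 : (S z).inverse (S z c) = c := by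
      obtain ⟨e, he⟩ := hz
      rw [← he]
      simp
    rw [← hc]
    change T z ((S z).inverse (S z c)) = T z c
    rw [h1]
  have hline : HasDerivAt (fun t : ℝ => w + t • v) v 0 := by
    simpa using ((hasDerivAt_id (0 : ℝ)).smul_const v).const_add w
  have h0 : w + (0 : ℝ) • v = w := by simp
  have hdl : HasDerivAt (fun t : ℝ => d (w + t • v)) (fderiv ℝ d w v) 0 := by
    refine HasFDerivAt.comp_hasDerivAt (0 : ℝ) ?_ hline
    rw [h0]; exact hd.hasFDerivAt
  have hcl : Tendsto (fun t : ℝ => w + t • v) (𝓝[≠] 0) (𝓝 w) := by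
    have := hline.continuousAt.tendsto
    rw [h0] at this
    exact this.mono_left nhdsWithin_le_nhds
  have hlim := hasDerivAt_iff_tendsto_slope.1 hdl
  have hlim2 : Tendsto (fun t : ℝ => R (w + t • v) (slope (fun t : ℝ => d (w + t • v)) 0 t)) (𝓝[≠] 0)
      (𝓝 (R w (fderiv ℝ d w v))) := by
    exact ((isBoundedBilinearMap_apply (𝕜 := ℂ) (E := E) (F := E)).continuous.tendsto _).comp
      ((hR.tendsto.comp hcl).prodMk_nhds hlim)
  have heq : (fun t : ℝ => R (w + t • v) (slope (fun t : ℝ => d (w + t • v)) 0 t)) =ᶠ[𝓝[≠] 0]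
      slope (fun t : ℝ => d (w + t • v)) 0 := by
    filter_upwards [hcl.eventually hRd] with t ht
    simp only [slope, vsub_eq_sub, zero_smul, add_zero, hd0, sub_zero]
    exact (((R (w + t • v)).restrictScalars ℝ).map_smul t⁻¹ _).trans (congrArg (t⁻¹ • ·) ht)
  have huniq := tendsto_nhds_unique (hlim2.congr' heq) hlim
  rw [← huniq, hTmem]
  exact ⟨_, rfl⟩

/-- Along a slice, the derivative of a map tangent to the slice is tangent to it. -/
lemma fderiv_tangent_slice {P : E →L[ℂ] C} {Q : G →L[ℂ] E} {f : E → E} {g₀ : G}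
    (hf : DifferentiableAt ℝ f (Q g₀)) (h : ∀ᶠ g in 𝓝 g₀, P (f (Q g)) = 0) (g : G) :
    P (fderiv ℝ f (Q g₀) (Q g)) = 0 := by
  have h1 : HasFDerivAt (fun g => P (f (Q g)))
      ((P.restrictScalars ℝ) ∘L (fderiv ℝ f (Q g₀) ∘L Q.restrictScalars ℝ)) g₀ :=
    (P.restrictScalars ℝ).hasFDerivAt.comp g₀
      (hf.hasFDerivAt.comp g₀ (Q.restrictScalars ℝ).hasFDerivAt)
  have h2 : HasFDerivAt (fun g => P (f (Q g))) (0 : G →L[ℝ] C) g₀ :=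
    (hasFDerivAt_const (0 : C) g₀).congr_of_eventuallyEq h
  exact congrArg (fun l : G →L[ℝ] C => l g) (h1.unique h2)

/-- The bracket only involves the derivatives of type `(1,0)` of the two fields. -/
lemma coordBracket_eq {a b : E → E} {w : E} (ha : DifferentiableAt ℝ a w)
    (hb : DifferentiableAt ℝ b w) :
    coordBracket a b w = (1 / 2 : ℂ) • ((fderiv ℝ b w (a w) - fderiv ℝ a w (b w)) -
      Complex.I • (fderiv ℝ b w (Complex.I • a w) - fderiv ℝ a w (Complex.I • b w))) := by
  simp only [coordBracket, lieBracket]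
  rw [fderiv_fun_const_smul ha, fderiv_fun_const_smul hb, smul_sub Complex.I]
  rfl

/-- The normal component of the bracket, at a point of the slice, depends only on the restriction to
the slice of the first field, when it takes values in a distribution tangent to the slice, and on
the normal component along the slice of the second one. -/
lemma coordBracket_normal_eq [FiniteDimensional ℂ E] {P : E →L[ℂ] C} {Q : G →L[ℂ] E}
    (hPQ : ∀ w, P w = 0 → ∃ g, Q g = w) {a a' b b' : E → E} {g₀ : G}
    (ha : DifferentiableAt ℝ a (Q g₀)) (ha' : DifferentiableAt ℝ a' (Q g₀))
    (hb : DifferentiableAt ℝ b (Q g₀)) (hb' : DifferentiableAt ℝ b' (Q g₀))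
    (hbb : ∀ᶠ g in 𝓝 g₀, P (b (Q g)) = P (b' (Q g))) (haa : a (Q g₀) = a' (Q g₀))
    (haP : ∀ᶠ g in 𝓝 g₀, P (a' (Q g)) = 0) {p : ℕ} {A : Fin p → E → E}
    (hA : ∀ i, ContinuousAt (A i) (Q g₀)) (hind : LinearIndependent ℂ fun i => A i (Q g₀))
    (hAP : ∀ i, P (A i (Q g₀)) = 0)
    (hmem : ∀ᶠ w in 𝓝 (Q g₀), a w - a' w ∈ Submodule.span ℂ (range fun i => A i w)) :
    P (coordBracket a b (Q g₀)) = P (coordBracket a' b' (Q g₀)) := by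
  set w := Q g₀
  obtain ⟨g₁, hg₁⟩ := hPQ _ haP.self_of_nhds
  have e1 (g : G) : P (fderiv ℝ b w (Q g)) = P (fderiv ℝ b' w (Q g)) := by
    have := fderiv_tangent_slice (P := P) (Q := Q) (hb.sub hb')
      (hbb.mono fun g hg => by simp [hg]) g
    rw [fderiv_sub hb hb'] at this
    simpa [sub_eq_zero] using this
  have e2 (x : E) : P (fderiv ℝ a w x) = P (fderiv ℝ a' w x) := by
    have h := fderiv_mem_span hA hind (ha.sub ha') (by simp [haa]) hmem x
    have h' : Submodule.span ℂ (range fun i => A i w) ≤ LinearMap.ker P.toLinearMap := by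
      rw [Submodule.span_le]
      rintro _ ⟨i, rfl⟩
      exact hAP i
    have h'' : P (fderiv ℝ (a - a') w x) = 0 := h' h
    rw [fderiv_sub ha ha'] at h''
    simpa [sub_eq_zero] using h''
  have e3 (x y : E) (hxy : P x = P y) : P (fderiv ℝ a' w x) = P (fderiv ℝ a' w y) := by
    obtain ⟨g, hg⟩ := hPQ (x - y) (by simp [hxy])
    have := fderiv_tangent_slice (P := P) (Q := Q) ha' haP g
    rw [hg] at this
    simpa [sub_eq_zero] using this
  have hbw := hbb.self_of_nhds
  have hIb : P (Complex.I • b w) = P (Complex.I • b' w) := by simp [w, hbw]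
  rw [coordBracket_eq ha hb, coordBracket_eq ha' hb', haa, ← hg₁, ← map_smul Q]
  simp only [map_smul, map_sub]
  simp only [← map_smul Q]
  rw [e1, e1, e2, e2, e3 _ _ hbw, e3 _ _ hIb]

end Calculus

/-! ### Cutoff functions and slice charts -/

section Cutoff

variable {E : Type*} [NormedAddCommGroup E] [NormedSpace ℂ E] [FiniteDimensional ℂ E]
  {M : Type*} [TopologicalSpace M] [T2Space M] [ChartedSpace E M] [IsManifold 𝓘(ℂ, E) ω M]

lemma exists_cutoff (x : M) {N : Set M} (hN : N ∈ 𝓝 x) :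
    ∃ χ : M → ℂ, SmoothFun (E := E) χ ∧ (∀ᶠ z in 𝓝 x, χ z = 1) ∧ tsupport χ ⊆ N := by
  have : FiniteDimensional ℝ E := FiniteDimensional.complexToReal E
  obtain ⟨f, -, hf⟩ := (SmoothBumpFunction.nhds_basis_tsupport (I := 𝓘(ℝ, E)) x).mem_iff.1 hN
  refine ⟨fun z => (f z : ℂ), ?_, ?_, ?_⟩
  · exact Complex.ofRealCLM.contMDiff.comp (f.contMDiff)
  · filter_upwards [f.eventuallyEq_one] with z hz
    simp [hz]
  · refine (closure_mono ?_).trans hf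
    intro z hz
    simpa using hz

omit [FiniteDimensional ℂ E] [T2Space M] in
lemma contMDiffAt_mul_complex {f g : M → ℂ} {z : M} (hf : ContMDiffAt 𝓘(ℝ, E) 𝓘(ℝ, ℂ) ∞ f z)
    (hg : ContMDiffAt 𝓘(ℝ, E) 𝓘(ℝ, ℂ) ∞ g z) :
    ContMDiffAt 𝓘(ℝ, E) 𝓘(ℝ, ℂ) ∞ (fun z => f z * g z) z := by
  have hc := chart_mem_maximalAtlas (I := 𝓘(ℂ, E)) (n := ω) z
  have hz := mem_chart_source E z
  rw [contMDiffAt_coord_iff hc hz] at *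
  exact ContDiffAt.mul hf hg

omit [FiniteDimensional ℂ E] [T2Space M] in
lemma smoothFun_cutoff_mul {χ f : M → ℂ} (hχ : SmoothFun (E := E) χ)
    (hf : ∀ z ∈ tsupport χ, ContMDiffAt 𝓘(ℝ, E) 𝓘(ℝ, ℂ) ∞ f z) :
    SmoothFun (E := E) fun z => χ z * f z := by
  intro z
  by_cases hz : z ∈ tsupport χ
  · exact contMDiffAt_mul_complex (hχ z) (hf z hz)
  · refine (contMDiffAt_const (c := (0 : ℂ))).congr_of_eventuallyEq ?_
    filter_upwards [(isClosed_tsupport χ).isOpen_compl.mem_nhds hz] with y hy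
    simp [image_eq_zero_of_notMem_tsupport hy]

omit [T2Space M] in
lemma smoothFieldAt_zero (y : M) :
    SmoothFieldAt (fun y : M => (0 : TangentSpace 𝓘(ℂ, E) y)) y := by
  have := FiniteDimensional.complete ℂ E
  rw [smoothFieldAt_iff (chart_mem_maximalAtlas (I := 𝓘(ℂ, E)) (n := ω) y) (mem_chart_source E y)]
  have : coordField ℂ (chartAt E y) (fun y : M => (0 : TangentSpace 𝓘(ℂ, E) y)) = fun _ => 0 :=
    funext fun w => map_zero (mfderiv 𝓘(ℂ, E) 𝓘(ℂ, E) (chartAt E y) ((chartAt E y).symm w))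
  rw [this]
  exact contDiffAt_const

omit [T2Space M] in
lemma smoothFieldAt_cutoff_smul {χ : M → ℂ} (hχ : SmoothFun (E := E) χ)
    {A : Π y : M, TangentSpace 𝓘(ℂ, E) y} (hA : ∀ z ∈ tsupport χ, SmoothFieldAt A z) (z : M) :
    SmoothFieldAt (fun y => χ y • A y) z := by
  have := FiniteDimensional.complete ℂ E
  by_cases hz : z ∈ tsupport χ
  · exact (hA z hz).smul (hχ z)
  · refine (smoothFieldAt_zero z).congr ?_
    filter_upwards [(isClosed_tsupport χ).isOpen_compl.mem_nhds hz] with y hy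
    rw [image_eq_zero_of_notMem_tsupport hy, zero_smul]

end Cutoff

lemma exists_isOpen_preimage_subset {M V : Type*} [TopologicalSpace M] [TopologicalSpace V]
    {ι : V → M} (hι : IsEmbedding ι) {N : Set V} {z : V} (hN : N ∈ 𝓝 z) :
    ∃ U : Set M, IsOpen U ∧ ι z ∈ U ∧ ι ⁻¹' U ⊆ N := by
  rw [hι.isInducing.nhds_eq_comap, mem_comap] at hN
  obtain ⟨t, ht, htN⟩ := hN
  obtain ⟨U, hUt, hU, hzU⟩ := mem_nhds_iff.1 ht
  exact ⟨U, hU, hzU, (preimage_mono hUt).trans htN⟩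

section Slice

variable {E : Type*} [NormedAddCommGroup E] [NormedSpace ℂ E]
  {G : Type*} [NormedAddCommGroup G] [NormedSpace ℂ G]
  {M : Type*} [TopologicalSpace M] [ChartedSpace E M]
  {V : Type*} [TopologicalSpace V] [ChartedSpace G V]

/-- Charts of `V` near `x` and of `M` near `ι x` in which `ι` is the inclusion of the slice
`G × {0}` into `G × C`. -/
structure SliceChart (C : Type*) [NormedAddCommGroup C] [NormedSpace ℂ C]
    [IsManifold 𝓘(ℂ, E) ω M] [IsManifold 𝓘(ℂ, G) ω V] (ι : V → M) (x : V) where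
  /-- the chart of the submanifold -/
  dom : OpenPartialHomeomorph V G
  /-- the chart of the ambient manifold -/
  cod : OpenPartialHomeomorph M E
  /-- the splitting of the ambient model space -/
  eqv : (G × C) ≃L[ℂ] E
  mem_source : x ∈ dom.source
  dom_mem : dom ∈ maximalAtlas 𝓘(ℂ, G) ω V
  cod_mem : cod ∈ maximalAtlas 𝓘(ℂ, E) ω M
  maps : ∀ z ∈ dom.source, ι z ∈ cod.source
  cod_eq : ∀ z ∈ dom.source, cod (ι z) = eqv (dom z, 0)
  smooth : ∀ z ∈ dom.source, MDifferentiableAt 𝓘(ℂ, G) 𝓘(ℂ, E) ι z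

variable [IsManifold 𝓘(ℂ, E) ω M] [IsManifold 𝓘(ℂ, G) ω V]

lemma exists_sliceChart.{u, v, w, t} {E : Type u} [NormedAddCommGroup E] [NormedSpace ℂ E]
    {G : Type v} [NormedAddCommGroup G] [NormedSpace ℂ G]
    {M : Type w} [TopologicalSpace M] [ChartedSpace E M]
    {V : Type t} [TopologicalSpace V] [ChartedSpace G V]
    [IsManifold 𝓘(ℂ, E) ω M] [IsManifold 𝓘(ℂ, G) ω V]
    {ι : V → M} (hι : Manifold.IsSmoothEmbedding 𝓘(ℂ, G) 𝓘(ℂ, E) ω ι)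
    (x : V) : ∃ (C : Type u) (_ : NormedAddCommGroup C) (_ : NormedSpace ℂ C),
      Nonempty (SliceChart (E := E) (G := G) C ι x) := by
  have h : Manifold.IsImmersionAt 𝓘(ℂ, G) 𝓘(ℂ, E) ω ι x := hι.isImmersion.isImmersionAt x
  refine ⟨h.complement, inferInstance, inferInstance, ⟨⟨h.domChart, h.codChart, h.equiv,
    h.mem_domChart_source, h.domChart_mem_maximalAtlas, h.codChart_mem_maximalAtlas,
    fun z hz => h.source_subset_preimage_source hz, fun z hz => ?_,
    fun z _ => (hι.contMDiff z).mdifferentiableAt (by simp)⟩⟩⟩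
  have hz' : h.domChart z ∈ (h.domChart.extend 𝓘(ℂ, G)).target := by
    simpa using h.domChart.map_source hz
  have := h.writtenInCharts hz'
  simpa [h.domChart.left_inv hz] using this

namespace SliceChart

variable {C : Type*} [NormedAddCommGroup C] [NormedSpace ℂ C] {ι : V → M} {x : V}
  (S : SliceChart (E := E) (G := G) C ι x)

/-- The inclusion of the slice. -/
def incl : G →L[ℂ] E := (S.eqv : (G × C) →L[ℂ] E) ∘L ContinuousLinearMap.inl ℂ G C

/-- The projection to the normal direction. -/
def nproj : E →L[ℂ] C := ContinuousLinearMap.snd ℂ G C ∘L (S.eqv.symm : E →L[ℂ] (G × C))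

/-- The projection to the slice. -/
def tproj : E →L[ℂ] G := ContinuousLinearMap.fst ℂ G C ∘L (S.eqv.symm : E →L[ℂ] (G × C))

/-- The splitting of the normal projection. -/
def nincl : C →L[ℂ] E := (S.eqv : (G × C) →L[ℂ] E) ∘L ContinuousLinearMap.inr ℂ G C

@[simp] lemma nproj_incl (g : G) : S.nproj (S.incl g) = 0 := by simp [nproj, incl]
@[simp] lemma tproj_incl (g : G) : S.tproj (S.incl g) = g := by simp [tproj, incl]
@[simp] lemma nproj_nincl (c : C) : S.nproj (S.nincl c) = c := by simp [nproj, nincl]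

lemma incl_tproj {w : E} (hw : S.nproj w = 0) : S.incl (S.tproj w) = w := by
  have : S.eqv.symm w = (S.tproj w, 0) := Prod.ext rfl hw
  have := congrArg S.eqv this
  simpa [incl] using this.symm

lemma cod_apply {z : V} (hz : z ∈ S.dom.source) : S.cod (ι z) = S.incl (S.dom z) := by
  simp [S.cod_eq z hz, incl]

/-- The derivative of the chart of `M`, as a map to the model space. -/
abbrev dcod (y : M) : TangentSpace 𝓘(ℂ, E) y →L[ℂ] E := mfderiv 𝓘(ℂ, E) 𝓘(ℂ, E) S.cod y

/-- The derivative of the chart of `V`, as a map to the model space. -/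
abbrev ddom (z : V) : TangentSpace 𝓘(ℂ, G) z →L[ℂ] G := mfderiv 𝓘(ℂ, G) 𝓘(ℂ, G) S.dom z

lemma dcod_mfderiv {z : V} (hz : z ∈ S.dom.source) (v : TangentSpace 𝓘(ℂ, G) z) :
    S.dcod (ι z) (mfderiv 𝓘(ℂ, G) 𝓘(ℂ, E) ι z v) = S.incl (S.ddom z v) := by
  have h1 := (mdifferentiable_chart_of_mem S.cod_mem (by simp)).mdifferentiableAt (S.maps z hz)
  have h2 := (mdifferentiable_chart_of_mem S.dom_mem (by simp)).mdifferentiableAt hz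
  have e1 := mfderiv_comp z h1 (S.smooth z hz)
  have e2 := mfderiv_comp z (I'' := 𝓘(ℂ, E)) (g := S.incl)
    (S.incl.contMDiff.mdifferentiableAt (n := 1) (by simp)) h2
  have e3 : S.cod ∘ ι =ᶠ[𝓝 z] S.incl ∘ S.dom := by
    filter_upwards [S.dom.open_source.mem_nhds hz] with z' hz'
    exact S.cod_apply hz'
  have e4 := e3.mfderiv_eq (I := 𝓘(ℂ, G)) (I' := 𝓘(ℂ, E))
  have e5 : mfderiv 𝓘(ℂ, G) 𝓘(ℂ, E) S.incl (S.dom z) = S.incl :=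
    (mfderiv_eq_fderiv).trans S.incl.fderiv
  have h := congrArg (fun l : G →L[ℂ] E => l v) (e1.symm.trans (e4.trans e2))
  exact h.trans (congrArg (fun l : G →L[ℂ] E => l (S.ddom z v)) e5)

lemma ddom_surjective {z : V} (hz : z ∈ S.dom.source) (g : G) : ∃ v, S.ddom z v = g := by
  have h := mfderiv_mfderiv_symm S.dom_mem (by simp) (S.dom.map_source hz) g
  rw [S.dom.left_inv hz] at h
  exact ⟨_, h⟩

lemma ddom_injective {z : V} (hz : z ∈ S.dom.source) {v w : TangentSpace 𝓘(ℂ, G) z}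
    (h : S.ddom z v = S.ddom z w) : v = w := by
  rw [← mfderiv_symm_mfderiv S.dom_mem (by simp) hz v,
    ← mfderiv_symm_mfderiv S.dom_mem (by simp) hz w]
  exact congrArg (mfderiv 𝓘(ℂ, G) 𝓘(ℂ, G) S.dom.symm (S.dom z) : G → G) h

lemma dcod_injective {y : M} (hy : y ∈ S.cod.source) {v w : TangentSpace 𝓘(ℂ, E) y}
    (h : S.dcod y v = S.dcod y w) : v = w := by
  rw [← mfderiv_symm_mfderiv S.cod_mem (by simp) hy v,
    ← mfderiv_symm_mfderiv S.cod_mem (by simp) hy w]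
  exact congrArg (mfderiv 𝓘(ℂ, E) 𝓘(ℂ, E) S.cod.symm (S.cod y) : E → E) h

lemma mem_tangentImage_iff {z : V} (hz : z ∈ S.dom.source) {a : TangentSpace 𝓘(ℂ, E) (ι z)} :
    a ∈ tangentImage (E := E) (G := G) ι z ↔ S.nproj (S.dcod (ι z) a) = 0 := by
  constructor
  · rintro ⟨v, rfl⟩
    have := S.dcod_mfderiv hz v
    exact (congrArg S.nproj this).trans (S.nproj_incl _)
  · intro h
    obtain ⟨v, hv⟩ := S.ddom_surjective hz (S.tproj (S.dcod (ι z) a))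
    refine ⟨v, S.dcod_injective (S.maps z hz) ?_⟩
    exact (S.dcod_mfderiv hz v).trans (by rw [hv, S.incl_tproj h])

lemma mfderiv_injective {z : V} (hz : z ∈ S.dom.source) :
    Function.Injective (mfderiv 𝓘(ℂ, G) 𝓘(ℂ, E) ι z) := by
  intro v w h
  refine S.ddom_injective hz ?_
  rw [← S.tproj_incl (S.ddom z v), ← S.tproj_incl (S.ddom z w), ← S.dcod_mfderiv hz,
    ← S.dcod_mfderiv hz, h]

/-- The coordinate of a normal vector in the trivialisation of the normal bundle over the slice
chart. Outside the domain of the chart it has no meaning. -/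
def normalCoord (z : V) (ξ : NormalSpace (E := E) (G := G) ι z) : C :=
  S.nproj (S.dcod (ι z) (Quotient.out ξ))

lemma normalCoord_mkQ {z : V} (hz : z ∈ S.dom.source) (a : TangentSpace 𝓘(ℂ, E) (ι z)) :
    S.normalCoord z ((tangentImage (E := E) (G := G) ι z).mkQ a) = S.nproj (S.dcod (ι z) a) := by
  have h : (Quotient.out ((tangentImage (E := E) (G := G) ι z).mkQ a)) - a ∈
      tangentImage (E := E) (G := G) ι z := by
    rw [← Submodule.Quotient.eq]
    exact Quotient.out_eq _
  rw [S.mem_tangentImage_iff hz, map_sub, map_sub, sub_eq_zero] at h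
  exact h

lemma normalCoord_add {z : V} (hz : z ∈ S.dom.source) (ξ η : NormalSpace (E := E) (G := G) ι z) :
    S.normalCoord z (ξ + η) = S.normalCoord z ξ + S.normalCoord z η := by
  obtain ⟨a, rfl⟩ := Submodule.mkQ_surjective _ ξ
  obtain ⟨b, rfl⟩ := Submodule.mkQ_surjective _ η
  have h := S.normalCoord_mkQ hz (a + b)
  rw [map_add, map_add, map_add] at h
  rw [h, S.normalCoord_mkQ hz, S.normalCoord_mkQ hz]

lemma normalCoord_smul {z : V} (hz : z ∈ S.dom.source) (r : ℂ)
    (ξ : NormalSpace (E := E) (G := G) ι z) :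
    S.normalCoord z (r • ξ) = r • S.normalCoord z ξ := by
  obtain ⟨a, rfl⟩ := Submodule.mkQ_surjective _ ξ
  have h := S.normalCoord_mkQ hz (r • a)
  rw [map_smul, map_smul, map_smul] at h
  rw [h, S.normalCoord_mkQ hz]

lemma normalCoord_injective {z : V} (hz : z ∈ S.dom.source)
    {ξ η : NormalSpace (E := E) (G := G) ι z} (h : S.normalCoord z ξ = S.normalCoord z η) :
    ξ = η := by
  obtain ⟨a, rfl⟩ := Submodule.mkQ_surjective _ ξ
  obtain ⟨b, rfl⟩ := Submodule.mkQ_surjective _ η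
  simp only [S.normalCoord_mkQ hz] at h
  refine (Submodule.Quotient.eq _).2 ((S.mem_tangentImage_iff hz).2 ?_)
  rw [map_sub, map_sub, h, sub_self]

/-- The normal coordinates at a point, as a linear map. -/
def normalCoordₗ {z : V} (hz : z ∈ S.dom.source) : NormalSpace (E := E) (G := G) ι z →ₗ[ℂ] C where
  toFun := S.normalCoord z
  map_add' := S.normalCoord_add hz
  map_smul' := S.normalCoord_smul hz

lemma smooth_normalCoord [CompleteSpace E] [CompleteSpace G]
    {s : Π z : V, NormalSpace (E := E) (G := G) ι z} (hs : SmoothSection ι s) {z : V}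
    (hz : z ∈ S.dom.source) :
    ContMDiffAt 𝓘(ℝ, G) 𝓘(ℝ, C) ∞ (fun z => S.normalCoord z (s z)) z := by
  obtain ⟨U, hU, hzU, A, hA, hAs⟩ := hs z
  have hA' := (smoothFieldOn_iff hU).1 hA _ hzU
  rw [smoothFieldAt_iff S.cod_mem (S.maps z hz), S.cod_apply hz] at hA'
  rw [contMDiffAt_coord_iff S.dom_mem hz]
  have h1 : ContDiffAt ℝ ∞ (fun g => S.nproj (coordField ℂ S.cod A (S.incl g))) (S.dom z) :=
    (S.nproj.restrictScalars ℝ).contDiff.contDiffAt.comp (S.dom z)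
      (hA'.comp (S.dom z) (S.incl.restrictScalars ℝ).contDiff.contDiffAt)
  refine h1.congr_of_eventuallyEq ?_
  have hc : ContinuousAt S.dom.symm (S.dom z) := S.dom.continuousAt_symm (S.dom.map_source hz)
  have hι : ContinuousAt ι z := (S.smooth z hz).continuousAt
  rw [ContinuousAt, S.dom.left_inv hz] at hc
  filter_upwards [S.dom.open_target.mem_nhds (S.dom.map_source hz),
    hc.eventually (hι.eventually (hU.mem_nhds hzU))] with g hg hg'
  have hg'' := S.dom.map_target hg
  have e := congrArg S.nproj (coordField_apply (c := S.cod) A (S.maps _ hg''))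
  rw [S.cod_apply hg'', S.dom.right_inv hg] at e
  refine Eq.trans ?_ e.symm
  simp only [Function.comp]
  rw [hAs _ hg', S.normalCoord_mkQ hg'']
  rfl

/-- Extension of a function on the submanifold, constant in the normal directions. -/
def extend (f : V → ℂ) : M → ℂ := fun y => f (S.dom.symm (S.tproj (S.cod y)))

lemma extend_apply (f : V → ℂ) {z : V} (hz : z ∈ S.dom.source) : S.extend f (ι z) = f z := by
  simp [extend, S.cod_apply hz, S.dom.left_inv hz]

lemma contMDiffAt_extend {f : V → ℂ} (hf : SmoothFun (E := G) f) {y : M} (hy : y ∈ S.cod.source)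
    (hy' : S.tproj (S.cod y) ∈ S.dom.target) :
    ContMDiffAt 𝓘(ℝ, E) 𝓘(ℝ, ℂ) ∞ (S.extend f) y := by
  have h1 := (contMDiffAt_of_mem_maximalAtlas (mem_maximalAtlas_real S.cod_mem) hy).of_le
    (m := ∞) le_top
  have h2 := (contMDiffAt_symm_of_mem_maximalAtlas (mem_maximalAtlas_real S.dom_mem) hy').of_le
    (m := ∞) le_top
  have h3 := (S.tproj.restrictScalars ℝ).contMDiff.contMDiffAt (x := S.cod y) (n := ∞)
  exact (hf _).comp y (h2.comp y (h3.comp y h1))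

end SliceChart

end Slice

/-! ### Differentials, brackets and locality of connections -/

section Functions

variable {G : Type*} [NormedAddCommGroup G] [NormedSpace ℂ G] [CompleteSpace G]
  {V : Type*} [TopologicalSpace V] [ChartedSpace G V] [IsManifold 𝓘(ℂ, G) ω V]

omit [CompleteSpace G] in
lemma differential_add {f g : V → ℂ} (hf : SmoothFun (E := G) f) (hg : SmoothFun (E := G) g)
    (x : V) (v : TangentSpace 𝓘(ℂ, G) x) :
    differential (fun z => f z + g z) x v = differential f x v + differential g x v := by
  have hc := chart_mem_maximalAtlas (I := 𝓘(ℂ, G)) (n := ω) x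
  have hx := mem_chart_source G x
  have hf' := (contMDiffAt_coord_iff hc hx).1 (hf x)
  have hg' := (contMDiffAt_coord_iff hc hx).1 (hg x)
  have hfg : ContMDiffAt 𝓘(ℝ, G) 𝓘(ℝ, ℂ) ∞ (fun z => f z + g z) x :=
    (contMDiffAt_coord_iff hc hx).2 (hf'.add hg')
  rw [differential_eq hc hx (hf x), differential_eq hc hx (hg x), differential_eq hc hx hfg]
  have := fderiv_add (hf'.differentiableAt (by simp)) (hg'.differentiableAt (by simp))
  exact congrArg (fun l : G →L[ℝ] ℂ => l (mfderiv 𝓘(ℂ, G) 𝓘(ℂ, G) _ x v)) this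

/-- The derivative of a smooth function along a smooth field is smooth. -/
lemma smoothFun_differential {f : V → ℂ} (hf : SmoothFun (E := G) f)
    {X : Π z : V, TangentSpace 𝓘(ℂ, G) z} (hX : ∀ z, SmoothFieldAt X z) :
    SmoothFun (E := G) (fun z => differential f z (X z)) := by
  intro x
  have hc := chart_mem_maximalAtlas (I := 𝓘(ℂ, G)) (n := ω) x
  have hx := mem_chart_source G x
  set c := chartAt G x
  have hf' := (contMDiffAt_coord_iff hc hx).1 (hf x)
  have hX' := (smoothFieldAt_iff hc hx).1 (hX x)
  rw [contMDiffAt_coord_iff hc hx]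
  have h : ContDiffAt ℝ ∞ (fun g => fderiv ℝ (f ∘ c.symm) g (coordField ℂ c X g)) (c x) :=
    (hf'.fderiv_right (m := ∞) (by simp)).clm_apply hX'
  refine h.congr_of_eventuallyEq ?_
  filter_upwards [c.open_target.mem_nhds (c.map_source hx)] with g hg
  simp only [Function.comp]
  rw [differential_eq hc (c.map_target hg) (hf _), c.right_inv hg]
  rfl

/-- The Lie bracket acts on functions as a commutator. -/
lemma differential_realBracket {f : V → ℂ} (hf : SmoothFun (E := G) f)
    {X Y : Π z : V, TangentSpace 𝓘(ℂ, G) z} (hX : ∀ z, SmoothFieldAt X z)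
    (hY : ∀ z, SmoothFieldAt Y z) (x : V) :
    differential f x (realBracket X Y x) =
      differential (fun z => differential f z (Y z)) x (X x) -
      differential (fun z => differential f z (X z)) x (Y x) := by
  have hc := chart_mem_maximalAtlas (I := 𝓘(ℂ, G)) (n := ω) x
  have hx := mem_chart_source G x
  set c := chartAt G x
  have hf' := (contMDiffAt_coord_iff hc hx).1 (hf x)
  have hX' := ((smoothFieldAt_iff hc hx).1 (hX x)).differentiableAt (by simp)
  have hY' := ((smoothFieldAt_iff hc hx).1 (hY x)).differentiableAt (by simp)
  have e (Z : Π z : V, TangentSpace 𝓘(ℂ, G) z) : (fun z => differential f z (Z z)) ∘ c.symm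
      =ᶠ[𝓝 (c x)] fun g => fderiv ℝ (f ∘ c.symm) g (coordField ℂ c Z g) := by
    filter_upwards [c.open_target.mem_nhds (c.map_source hx)] with g hg
    simp only [Function.comp]
    rw [differential_eq hc (c.map_target hg) (hf _), c.right_inv hg]
    rfl
  rw [differential_eq hc hx (hf x), differential_eq hc hx (smoothFun_differential hf hX x),
    differential_eq hc hx (smoothFun_differential hf hY x), (e X).fderiv_eq, (e Y).fderiv_eq,
    ← coordField_apply X hx, ← coordField_apply Y hx, ← coordField_apply (realBracket X Y) hx,
    coordField_realBracket hc hx (hX x) (hY x)]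
  exact (fderiv_fderiv_sub_fderiv_fderiv (hf'.of_le (by norm_cast)) hX' hY').symm

lemma realBracket_swap (X Y : Π z : V, TangentSpace 𝓘(ℂ, G) z) (x : V) :
    realBracket X Y x = -realBracket Y X x :=
  mlieBracket_swap_apply

lemma realBracket_congr {X X' Y Y' : Π z : V, TangentSpace 𝓘(ℂ, G) z} {x : V}
    (hX : ∀ᶠ z in 𝓝 x, X z = X' z) (hY : ∀ᶠ z in 𝓝 x, Y z = Y' z) :
    realBracket X Y x = realBracket X' Y' x :=
  Filter.EventuallyEq.mlieBracket_vectorField_eq (I := 𝓘(ℝ, G)) hX hY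

lemma realBracket_add_left {X X' Y : Π z : V, TangentSpace 𝓘(ℂ, G) z} {x : V}
    (hX : SmoothFieldAt X x) (hX' : SmoothFieldAt X' x) (hY : SmoothFieldAt Y x) :
    realBracket (fun z => X z + X' z) Y x = realBracket X Y x + realBracket X' Y x := by
  have hc := chart_mem_maximalAtlas (I := 𝓘(ℂ, G)) (n := ω) x
  have hx := mem_chart_source G x
  refine (mdifferentiable_chart_of_mem hc (by simp)).mfderiv_injective hx ?_
  have e1 := coordField_realBracket hc hx hX hY
  have e2 := coordField_realBracket hc hx hX' hY
  have e3 := coordField_realBracket hc hx (hX.add hX') hY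
  rw [coordField_apply _ hx] at e1 e2 e3
  rw [map_add]
  refine e3.trans (Eq.trans ?_ (congrArg₂ (· + ·) e1 e2).symm)
  rw [coordField_add]
  exact lieBracket_add_left (((smoothFieldAt_iff hc hx).1 hX).differentiableAt (by simp))
    (((smoothFieldAt_iff hc hx).1 hX').differentiableAt (by simp))

/-- The Lie bracket of real fields obeys the Leibniz rule for real coefficients only. -/
lemma realBracket_smul_left {f : V → ℝ} (hf : SmoothFun (E := G) fun z => (f z : ℂ))
    {X Y : Π z : V, TangentSpace 𝓘(ℂ, G) z} {x : V}
    (hX : SmoothFieldAt X x) (hY : SmoothFieldAt Y x) :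
    realBracket (fun z => (f z : ℂ) • X z) Y x =
      -(differential (fun z => (f z : ℂ)) x (Y x)) • X x + (f x : ℂ) • realBracket X Y x := by
  have hc := chart_mem_maximalAtlas (I := 𝓘(ℂ, G)) (n := ω) x
  have hx := mem_chart_source G x
  refine (mdifferentiable_chart_of_mem hc (by simp)).mfderiv_injective hx ?_
  have e1 := coordField_realBracket hc hx hX hY
  have e3 := coordField_realBracket hc hx (hX.smul (hf x)) hY
  rw [coordField_apply _ hx] at e1 e3
  refine e3.trans ?_
  rw [map_add, map_smul, map_smul, e1, ← coordField_apply X hx, coordField_smul,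
    differential_eq hc hx (hf x), ← coordField_apply Y hx]
  set c := chartAt G x
  have hf' : DifferentiableAt ℝ (fun g => f (c.symm g)) (c x) := by
    have := (((contMDiffAt_coord_iff hc hx).1 (hf x)).differentiableAt (by simp))
    exact Complex.reCLM.differentiableAt.comp (c x) this
  have h := lieBracket_smul_left (W := coordField ℂ c Y) hf'
    (((smoothFieldAt_iff hc hx).1 hX).differentiableAt (by simp))
  have h2 : fderiv ℝ ((fun z => (f z : ℂ)) ∘ c.symm) (c x) =
      Complex.ofRealCLM ∘L fderiv ℝ (fun g => f (c.symm g)) (c x) :=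
    (Complex.ofRealCLM.hasFDerivAt.comp (c x) hf'.hasFDerivAt).fderiv
  rw [h2, c.left_inv hx] at *
  rw [ContinuousLinearMap.comp_apply, Complex.ofRealCLM_apply, ← Complex.ofReal_neg]
  simp only [Complex.coe_smul]
  exact h

end Functions

section Sections

variable {E : Type*} [NormedAddCommGroup E] [NormedSpace ℂ E] [FiniteDimensional ℂ E]
  {G : Type*} [NormedAddCommGroup G] [NormedSpace ℂ G] [FiniteDimensional ℂ G]
  {M : Type*} [TopologicalSpace M] [T2Space M] [ChartedSpace E M] [IsManifold 𝓘(ℂ, E) ω M]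
  {V : Type*} [TopologicalSpace V] [T2Space V] [ChartedSpace G V] [IsManifold 𝓘(ℂ, G) ω V]
  {ι : V → M}

lemma SmoothSection.add {s t : Π x : V, NormalSpace (E := E) (G := G) ι x}
    (hs : SmoothSection ι s) (ht : SmoothSection ι t) : SmoothSection ι fun z => s z + t z := by
  intro x
  have := FiniteDimensional.complete ℂ E
  obtain ⟨U, hU, hxU, A, hA, hAs⟩ := hs x
  obtain ⟨U', hU', hxU', B, hB, hBt⟩ := ht x
  refine ⟨U ∩ U', hU.inter hU', ⟨hxU, hxU'⟩, fun z => A z + B z, ?_, ?_⟩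
  · rw [smoothFieldOn_iff (hU.inter hU')]
    exact fun y hy => ((smoothFieldOn_iff hU).1 hA y hy.1).add ((smoothFieldOn_iff hU').1 hB y hy.2)
  · intro z hz
    exact (congrArg₂ (· + ·) (hAs z hz.1) (hBt z hz.2)).trans (map_add _ _ _).symm

/-- Smooth functions on the submanifold extend locally to the ambient manifold, so the sections
induced by smooth ambient fields are stable under multiplication by them. -/
lemma SmoothSection.smul (hι : Manifold.IsSmoothEmbedding 𝓘(ℂ, G) 𝓘(ℂ, E) ω ι) {f : V → ℂ}
    (hf : SmoothFun (E := G) f) {s : Π x : V, NormalSpace (E := E) (G := G) ι x}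
    (hs : SmoothSection ι s) : SmoothSection ι fun z => f z • s z := by
  intro x
  have := FiniteDimensional.complete ℂ E
  obtain ⟨C, _, _, ⟨S⟩⟩ := exists_sliceChart hι x
  obtain ⟨U, hU, hxU, A, hA, hAs⟩ := hs x
  obtain ⟨U', hU', hxU', hU'S⟩ := exists_isOpen_preimage_subset hι.isEmbedding
    (S.dom.open_source.mem_nhds S.mem_source)
  have hW : IsOpen (S.cod.source ∩ S.cod ⁻¹' (S.tproj ⁻¹' S.dom.target)) :=
    S.cod.isOpen_inter_preimage (S.dom.open_target.preimage S.tproj.continuous)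
  have hx := S.mem_source
  refine ⟨U ∩ U' ∩ (S.cod.source ∩ S.cod ⁻¹' (S.tproj ⁻¹' S.dom.target)),
    (hU.inter hU').inter hW, ⟨⟨hxU, hxU'⟩, S.maps x hx, ?_⟩, fun y => S.extend f y • A y, ?_, ?_⟩
  · simp [S.cod_apply hx, S.dom.map_source hx]
  · rw [smoothFieldOn_iff ((hU.inter hU').inter hW)]
    exact fun y hy => ((smoothFieldOn_iff hU).1 hA y hy.1.1).smul
      (S.contMDiffAt_extend hf hy.2.1 hy.2.2)
  · intro z hz
    change f z • s z = (tangentImage ι z).mkQ (S.extend f (ι z) • A (ι z))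
    rw [S.extend_apply f (hU'S hz.1.2), hAs z hz.1.1]
    exact (map_smul _ _ _).symm

lemma SmoothSection.const_smul (hι : Manifold.IsSmoothEmbedding 𝓘(ℂ, G) 𝓘(ℂ, E) ω ι) (r : ℂ)
    {s : Π x : V, NormalSpace (E := E) (G := G) ι x}
    (hs : SmoothSection ι s) : SmoothSection ι fun z => r • s z :=
  SmoothSection.smul hι (f := fun _ => r) contMDiff_const hs

lemma smoothSection_zero : SmoothSection ι fun x => (0 : NormalSpace (E := E) (G := G) ι x) :=
  fun x => ⟨univ, isOpen_univ, trivial, fun _ => 0,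
    (smoothFieldOn_iff isOpen_univ).2 fun y _ => smoothFieldAt_zero y, fun z _ => by rw [map_zero]⟩

lemma smoothSection_sum {α : Type*} (t : Finset α) {s : α → Π x : V, NormalSpace (E := E) (G := G) ι x}
    (hs : ∀ i, SmoothSection ι (s i)) : SmoothSection ι fun z => ∑ i ∈ t, s i z := by
  classical
  induction t using Finset.induction_on with
  | empty => simpa using smoothSection_zero
  | insert a t ha ih => simpa [Finset.sum_insert ha] using (hs a).add ih

lemma smoothField_sum {α : Type*} (t : Finset α) {X : α → Π x : V, TangentSpace 𝓘(ℂ, G) x}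
    (hX : ∀ i z, SmoothFieldAt (X i) z) (z : V) : SmoothFieldAt (fun z => ∑ i ∈ t, X i z) z := by
  classical
  have := FiniteDimensional.complete ℂ G
  induction t using Finset.induction_on with
  | empty => simpa using smoothFieldAt_zero z
  | insert a t ha ih => simpa [Finset.sum_insert ha] using (hX a z).add ih

namespace NormalConnection

variable (hι : Manifold.IsSmoothEmbedding 𝓘(ℂ, G) 𝓘(ℂ, E) ω ι)
  (D : NormalConnection (E := E) (G := G) ι)

include hι in
/-- A connection is a local operator. -/
lemma toFun_congr {s t : Π x : V, NormalSpace (E := E) (G := G) ι x} (hs : SmoothSection ι s)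
    (ht : SmoothSection ι t) {x : V} (h : ∀ᶠ z in 𝓝 x, s z = t z) (v : TangentSpace 𝓘(ℂ, G) x) :
    D.toFun s x v = D.toFun t x v := by
  -- the difference `r` of the sections is `(1 - χ) r` with `1 - χ` zero near `x`, so the Leibniz rule
  -- gives `D r = 0` at `x`
  obtain ⟨χ, hχ, hχ1, hχs⟩ := exists_cutoff (E := G) x h
  set r : Π x : V, NormalSpace (E := E) (G := G) ι x := fun z => s z + (-1 : ℂ) • t z
  have hr : SmoothSection ι r := hs.add (ht.const_smul hι (-1))
  have hχ' : SmoothFun (E := G) fun z => 1 + (-1) * χ z := fun z => by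
    have hc := chart_mem_maximalAtlas (I := 𝓘(ℂ, G)) (n := ω) z
    have hz := mem_chart_source G z
    have := (contMDiffAt_coord_iff hc hz).1 (hχ z)
    exact (contMDiffAt_coord_iff hc hz).2 (contDiffAt_const.add (contDiffAt_const.mul this))
  have e1 : (fun z => (1 + (-1) * χ z) • r z) = r := by
    funext z
    by_cases hz : s z = t z
    · simp [r, hz]
    · have : χ z = 0 := image_eq_zero_of_notMem_tsupport fun hz' => hz (hχs hz')
      simp [this]
  have h0 := D.leibniz _ r hχ' hr x v
  have hrx : r x = 0 := by simp [r, h.self_of_nhds]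
  rw [e1, hrx, hχ1.self_of_nhds] at h0
  have e2 : s = fun z => t z + r z := by
    funext z; simp [r]
  rw [e2, D.map_add t r ht hr, h0]
  simp

end NormalConnection

end Sections

/-! ### Local frames -/

section Frames

variable {E : Type*} [NormedAddCommGroup E] [NormedSpace ℂ E] [FiniteDimensional ℂ E]
  {G : Type*} [NormedAddCommGroup G] [NormedSpace ℂ G] [FiniteDimensional ℂ G]
  {M : Type*} [TopologicalSpace M] [T2Space M] [ChartedSpace E M] [IsManifold 𝓘(ℂ, E) ω M]
  {V : Type*} [TopologicalSpace V] [T2Space V] [ChartedSpace G V] [IsManifold 𝓘(ℂ, G) ω V]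
  {ι : V → M}

lemma smoothFieldAt_fieldOfCoord {c : OpenPartialHomeomorph V G}
    (hc : c ∈ maximalAtlas 𝓘(ℂ, G) ω V) {a : G → G} {z : V} (hz : z ∈ c.source)
    (ha : ContDiffAt ℝ ∞ a (c z)) : SmoothFieldAt (fieldOfCoord ℂ c a) z := by
  have := FiniteDimensional.complete ℂ G
  rw [smoothFieldAt_iff hc hz]
  refine ha.congr_of_eventuallyEq ?_
  filter_upwards [c.open_target.mem_nhds (c.map_source hz)] with g hg
  exact coordField_fieldOfCoord hc (by simp) a hg

lemma holomorphicFieldAt_fieldOfCoord {c : OpenPartialHomeomorph V G}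
    (hc : c ∈ maximalAtlas 𝓘(ℂ, G) ω V) {a : G → G} {z : V} (hz : z ∈ c.source)
    (ha : ContDiffAt ℂ ω a (c z)) : HolomorphicFieldAt (fieldOfCoord ℂ c a) z := by
  have := FiniteDimensional.complete ℂ G
  rw [holomorphicFieldAt_iff hc hz]
  refine ha.congr_of_eventuallyEq ?_
  filter_upwards [c.open_target.mem_nhds (c.map_source hz)] with g hg
  exact coordField_fieldOfCoord hc (by simp) a hg

/-- A field smooth near `x` agrees near `x` with a multiple of it which is smooth everywhere. -/
lemma exists_smoothField_eventuallyEq {A : Π z : V, TangentSpace 𝓘(ℂ, G) z} {x : V}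
    (hA : ∀ᶠ z in 𝓝 x, SmoothFieldAt A z) :
    ∃ χ : V → ℂ, (∀ z, SmoothFieldAt (fun z => χ z • A z) z) ∧
      ∀ᶠ z in 𝓝 x, χ z • A z = A z := by
  obtain ⟨χ, hχ, hχ1, hχs⟩ := exists_cutoff (E := G) x hA
  refine ⟨χ, smoothFieldAt_cutoff_smul hχ fun z hz => hχs hz, ?_⟩
  filter_upwards [hχ1] with z hz
  rw [hz, one_smul]

/-- Near a point, a smooth field is a combination of fixed smooth fields, with real smooth
coefficients whose values at the point are determined by the value of the field. -/
lemma exists_field_frame (x : V) :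
    ∃ (m : ℕ) (X : Fin m → Π z : V, TangentSpace 𝓘(ℂ, G) z)
      (L : Fin m → TangentSpace 𝓘(ℂ, G) x → ℝ), (∀ i z, SmoothFieldAt (X i) z) ∧
      ∀ Y : Π z : V, TangentSpace 𝓘(ℂ, G) z, (∀ z, SmoothFieldAt Y z) →
        ∃ f : Fin m → V → ℝ, (∀ i, SmoothFun (E := G) fun z => (f i z : ℂ)) ∧
          (∀ i, f i x = L i (Y x)) ∧ ∀ᶠ z in 𝓝 x, Y z = ∑ i, (f i z : ℂ) • X i z := by
  have := FiniteDimensional.complete ℂ G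
  have : FiniteDimensional ℝ G := FiniteDimensional.complexToReal G
  have hc := chart_mem_maximalAtlas (I := 𝓘(ℂ, G)) (n := ω) x
  have hx := mem_chart_source G x
  set c := chartAt G x
  let b := Module.finBasis ℝ G
  obtain ⟨χ, hχ, hχ1, hχs⟩ := exists_cutoff (E := G) x (c.open_source.mem_nhds hx)
  let l (i) : G →L[ℝ] ℝ := (b.coord i).toContinuousLinearMap
  refine ⟨_, fun i z => χ z • fieldOfCoord ℂ c (fun _ => b i) z,
    fun i v => l i (mfderiv 𝓘(ℂ, G) 𝓘(ℂ, G) c x v), ?_, ?_⟩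
  · exact fun i z => smoothFieldAt_cutoff_smul hχ
      (fun z hz => smoothFieldAt_fieldOfCoord hc (hχs hz) contDiffAt_const) z
  intro Y hY
  have hF (i) : SmoothFun (E := G) fun z => χ z * (l i (coordField ℂ c Y (c z)) : ℂ) := by
    refine smoothFun_cutoff_mul hχ fun z hz => ?_
    have h1 := (smoothFieldAt_iff hc (hχs hz)).1 (hY z)
    rw [contMDiffAt_coord_iff hc (hχs hz)]
    have h2 : ContDiffAt ℝ ∞ (fun g => Complex.ofRealCLM (l i (coordField ℂ c Y g))) (c z) :=
      Complex.ofRealCLM.contDiff.contDiffAt.comp (c z) ((l i).contDiff.contDiffAt.comp (c z) h1)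
    refine h2.congr_of_eventuallyEq ?_
    filter_upwards [c.open_target.mem_nhds (c.map_source (hχs hz))] with g hg
    simp [c.right_inv hg]
  refine ⟨fun i z => (χ z * (l i (coordField ℂ c Y (c z)) : ℂ)).re, fun i => ?_, fun i => ?_, ?_⟩
  · exact (Complex.ofRealCLM ∘L Complex.reCLM).contMDiff.comp (hF i)
  · simp [hχ1.self_of_nhds, coordField_apply Y hx]
  · filter_upwards [hχ1, c.open_source.mem_nhds hx] with z hz hz'
    refine (mdifferentiable_chart_of_mem hc (by simp)).mfderiv_injective hz' ?_
    refine (coordField_apply Y hz').symm.trans (Eq.trans ?_ (map_sum _ _ _).symm)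
    have e (i) (r : ℝ) : mfderiv 𝓘(ℂ, G) 𝓘(ℂ, G) c z
        ((r : ℂ) • χ z • fieldOfCoord ℂ c (fun _ => b i) z) = (r : ℂ) • b i := by
      rw [hz, one_smul, map_smul, ← coordField_apply _ hz',
        coordField_fieldOfCoord hc (by simp) _ (c.map_source hz')]
      rfl
    refine Eq.trans ?_ (Finset.sum_congr rfl fun i _ => (e i _).symm)
    simp only [hz, one_mul, Complex.ofReal_re, Complex.coe_smul]
    exact (b.sum_repr (coordField ℂ c Y (c z))).symm

/-- Sections of the normal bundle which are constant in a slice chart near the centre. -/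
lemma SliceChart.exists_section {C : Type*} [NormedAddCommGroup C] [NormedSpace ℂ C]
    {x : V} (S : SliceChart (E := E) (G := G) C ι x) (a : C) :
    ∃ s : Π z : V, NormalSpace (E := E) (G := G) ι z, SmoothSection ι s ∧ HolomorphicNear ι s x ∧
      ∀ᶠ z in 𝓝 x, S.normalCoord z (s z) = a := by
  have hx := S.mem_source
  have hιx := S.maps x hx
  obtain ⟨χ, hχ, hχ1, hχs⟩ := exists_cutoff (E := E) (ι x) (S.cod.open_source.mem_nhds hιx)
  set B := fieldOfCoord ℂ S.cod (fun _ => S.nincl a)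
  have hB (y) (hy : y ∈ S.cod.source) : HolomorphicFieldAt B y :=
    holomorphicFieldAt_fieldOfCoord S.cod_mem hy contDiffAt_const
  obtain ⟨U, hUs, hU, hxU⟩ := mem_nhds_iff.1
    (inter_mem hχ1 (S.cod.open_source.mem_nhds hιx))
  refine ⟨fun z => (tangentImage (E := E) (G := G) ι z).mkQ (χ (ι z) • B (ι z)), ?_, ?_, ?_⟩
  · exact fun z => ⟨univ, isOpen_univ, trivial, fun y => χ y • B y,
      (smoothFieldOn_iff isOpen_univ).2 fun y _ => smoothFieldAt_cutoff_smul hχ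
        (fun y hy => (hB y (hχs hy)).smoothFieldAt) y, fun z _ => rfl⟩
  · refine ⟨U, hU, hxU, B, (holomorphicFieldOn_iff hU).2 fun y hy => hB y (hUs hy).2, ?_⟩
    intro z hz
    have : χ (ι z) = 1 := (hUs hz).1
    simp only [this, one_smul]
  · have hι : ContinuousAt ι x := (S.smooth x hx).continuousAt
    filter_upwards [hι.eventually hχ1, S.dom.open_source.mem_nhds hx] with z hz hz'
    rw [S.normalCoord_mkQ hz', hz, one_smul]
    have e : S.dcod (ι z) (B (ι z)) = S.nincl a :=
      (coordField_apply B (S.maps z hz')).symm.trans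
        (coordField_fieldOfCoord S.cod_mem (by simp) _ (S.cod.map_source (S.maps z hz')))
    rw [e, S.nproj_nincl]

lemma exists_holomorphic_section (hι : Manifold.IsSmoothEmbedding 𝓘(ℂ, G) 𝓘(ℂ, E) ω ι) (x : V)
    (ξ : NormalSpace (E := E) (G := G) ι x) :
    ∃ s : Π z : V, NormalSpace (E := E) (G := G) ι z, SmoothSection ι s ∧ HolomorphicNear ι s x ∧
      s x = ξ := by
  obtain ⟨C, _, _, ⟨S⟩⟩ := exists_sliceChart hι x
  obtain ⟨s, h1, h2, h3⟩ := S.exists_section (S.normalCoord x ξ)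
  exact ⟨s, h1, h2, S.normalCoord_injective S.mem_source h3.self_of_nhds⟩

/-- Near a point, a smooth section of the normal bundle is a combination of fixed smooth sections,
with smooth coefficients whose values at the point are determined by the value of the section. -/
lemma exists_section_frame (hι : Manifold.IsSmoothEmbedding 𝓘(ℂ, G) 𝓘(ℂ, E) ω ι) (x : V) :
    ∃ (m : ℕ) (s : Fin m → Π z : V, NormalSpace (E := E) (G := G) ι z)
      (L : Fin m → NormalSpace (E := E) (G := G) ι x → ℂ), (∀ i, SmoothSection ι (s i)) ∧
      ∀ t : Π z : V, NormalSpace (E := E) (G := G) ι z, SmoothSection ι t →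
        ∃ f : Fin m → V → ℂ, (∀ i, SmoothFun (E := G) (f i)) ∧ (∀ i, f i x = L i (t x)) ∧
          ∀ᶠ z in 𝓝 x, t z = ∑ i, f i z • s i z := by
  have := FiniteDimensional.complete ℂ G
  have := FiniteDimensional.complete ℂ E
  obtain ⟨C, _, _, ⟨S⟩⟩ := exists_sliceChart hι x
  have hx := S.mem_source
  have : FiniteDimensional ℂ C :=
    FiniteDimensional.of_injective S.nincl.toLinearMap
      (Function.LeftInverse.injective S.nproj_nincl)
  let b := Module.finBasis ℂ C
  choose s hs1 hs2 hs3 using fun i => S.exists_section (b i)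
  let l (i) : C →L[ℂ] ℂ := (b.coord i).toContinuousLinearMap
  obtain ⟨χ, hχ, hχ1, hχs⟩ := exists_cutoff (E := G) x (S.dom.open_source.mem_nhds hx)
  refine ⟨_, s, fun i ξ => l i (S.normalCoord x ξ), hs1, fun t ht => ?_⟩
  refine ⟨fun i z => χ z * l i (S.normalCoord z (t z)), fun i => ?_, fun i => ?_, ?_⟩
  · refine smoothFun_cutoff_mul hχ fun z hz => ?_
    exact ((l i).restrictScalars ℝ).contMDiff.contMDiffAt.comp z (S.smooth_normalCoord ht (hχs hz))
  · simp [hχ1.self_of_nhds]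
  · filter_upwards [hχ1, S.dom.open_source.mem_nhds hx, eventually_all.2 hs3] with z hz hz' hz3
    refine S.normalCoord_injective hz' ?_
    have e : S.normalCoord z (∑ i, (χ z * l i (S.normalCoord z (t z))) • s i z) =
        ∑ i, (χ z * l i (S.normalCoord z (t z))) • S.normalCoord z (s i z) := by
      have := map_sum (S.normalCoordₗ hz')
        (fun i => (χ z * l i (S.normalCoord z (t z))) • s i z) Finset.univ
      simp only [map_smul] at this
      exact this
    rw [e]
    simp only [hz3, hz, one_mul]
    exact (b.sum_repr (S.normalCoord z (t z))).symm

end Frames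

/-! ### Tensoriality of the curvature -/

section Curvature

variable {E : Type*} [NormedAddCommGroup E] [NormedSpace ℂ E] [FiniteDimensional ℂ E]
  {G : Type*} [NormedAddCommGroup G] [NormedSpace ℂ G] [FiniteDimensional ℂ G]
  {M : Type*} [TopologicalSpace M] [T2Space M] [ChartedSpace E M] [IsManifold 𝓘(ℂ, E) ω M]
  {V : Type*} [TopologicalSpace V] [T2Space V] [ChartedSpace G V] [IsManifold 𝓘(ℂ, G) ω V]
  {ι : V → M}

namespace NormalConnection

variable (hι : Manifold.IsSmoothEmbedding 𝓘(ℂ, G) 𝓘(ℂ, E) ω ι)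
  (D : NormalConnection (E := E) (G := G) ι)
  {X X' Y Y' : Π z : V, TangentSpace 𝓘(ℂ, G) z}
  {s t : Π z : V, NormalSpace (E := E) (G := G) ι z} {x : V}

lemma smooth_deriv (hs : SmoothSection ι s) (hX : ∀ z, SmoothFieldAt X z) :
    SmoothSection ι fun z => D.toFun s z (X z) :=
  D.smooth s X hs ((smoothFieldOn_iff isOpen_univ).2 fun z _ => hX z)

lemma curvatureOnFields_swap :
    D.curvatureOnFields X Y s x = -D.curvatureOnFields Y X s x := by
  simp only [curvatureOnFields]
  rw [realBracket_swap X Y x, map_neg]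
  abel

include hι in
lemma curvatureOnFields_congr (hX : ∀ z, SmoothFieldAt X z) (hX' : ∀ z, SmoothFieldAt X' z)
    (hY : ∀ z, SmoothFieldAt Y z) (hY' : ∀ z, SmoothFieldAt Y' z) (hs : SmoothSection ι s)
    (ht : SmoothSection ι t) (hXX : ∀ᶠ z in 𝓝 x, X z = X' z) (hYY : ∀ᶠ z in 𝓝 x, Y z = Y' z)
    (hst : ∀ᶠ z in 𝓝 x, s z = t z) :
    D.curvatureOnFields X Y s x = D.curvatureOnFields X' Y' t x := by
  have e {Z Z' : Π z : V, TangentSpace 𝓘(ℂ, G) z} (hZ : ∀ᶠ z in 𝓝 x, Z z = Z' z) :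
      ∀ᶠ z in 𝓝 x, D.toFun s z (Z z) = D.toFun t z (Z' z) := by
    filter_upwards [hZ, eventually_eventually_nhds.2 hst] with z hz hz'
    rw [hz, toFun_congr hι D hs ht hz']
  simp only [curvatureOnFields]
  rw [realBracket_congr hXX hYY, toFun_congr hι D hs ht hst,
    toFun_congr hι D (D.smooth_deriv hs hY) (D.smooth_deriv ht hY') (e hYY),
    toFun_congr hι D (D.smooth_deriv hs hX) (D.smooth_deriv ht hX') (e hXX),
    hXX.self_of_nhds, hYY.self_of_nhds]

lemma curvatureOnFields_add_left (hX : ∀ z, SmoothFieldAt X z) (hX' : ∀ z, SmoothFieldAt X' z)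
    (hY : ∀ z, SmoothFieldAt Y z) (hs : SmoothSection ι s) :
    D.curvatureOnFields (fun z => X z + X' z) Y s x =
      D.curvatureOnFields X Y s x + D.curvatureOnFields X' Y s x := by
  have := FiniteDimensional.complete ℂ G
  simp only [curvatureOnFields]
  rw [realBracket_add_left (hX x) (hX' x) (hY x)]
  simp only [_root_.map_add]
  rw [D.map_add _ _ (D.smooth_deriv hs hX) (D.smooth_deriv hs hX')]
  abel

lemma toFun_ofReal_smul (r : ℝ) (v : TangentSpace 𝓘(ℂ, G) x) :
    D.toFun s x ((r : ℂ) • v) = (r : ℂ) • D.toFun s x v := by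
  have := (D.toFun s x).map_smul r v
  exact this

include hι in
lemma curvatureOnFields_smul_left {f : V → ℝ} (hf : SmoothFun (E := G) fun z => (f z : ℂ))
    (hX : ∀ z, SmoothFieldAt X z) (hY : ∀ z, SmoothFieldAt Y z) (hs : SmoothSection ι s) :
    D.curvatureOnFields (fun z => (f z : ℂ) • X z) Y s x =
      (f x : ℂ) • D.curvatureOnFields X Y s x := by
  have := FiniteDimensional.complete ℂ G
  -- the derivative of `f` is real, and `∇` is linear over the reals in the direction
  have hre : ∃ r : ℝ, differential (fun z => (f z : ℂ)) x (Y x) = r := by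
    have hc := chart_mem_maximalAtlas (I := 𝓘(ℂ, G)) (n := ω) x
    have hx := mem_chart_source G x
    set c := chartAt G x
    have hf' : DifferentiableAt ℝ (fun g => f (c.symm g)) (c x) := by
      have := (((contMDiffAt_coord_iff hc hx).1 (hf x)).differentiableAt (by simp))
      exact Complex.reCLM.differentiableAt.comp (c x) this
    have h2 : fderiv ℝ ((fun z => (f z : ℂ)) ∘ c.symm) (c x) =
        Complex.ofRealCLM ∘L fderiv ℝ (fun g => f (c.symm g)) (c x) :=
      (Complex.ofRealCLM.hasFDerivAt.comp (c x) hf'.hasFDerivAt).fderiv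
    rw [differential_eq hc hx (hf x), h2]
    exact ⟨_, rfl⟩
  obtain ⟨r, hr⟩ := hre
  simp only [curvatureOnFields]
  rw [realBracket_smul_left hf (hX x) (hY x), hr, ← Complex.ofReal_neg]
  simp only [_root_.map_add, toFun_ofReal_smul]
  rw [D.leibniz _ _ hf (D.smooth_deriv hs hX), hr, Complex.ofReal_neg]
  simp only [smul_sub, neg_smul]
  abel

include hι in
lemma curvatureOnFields_smul_section {f : V → ℂ} (hf : SmoothFun (E := G) f)
    (hX : ∀ z, SmoothFieldAt X z) (hY : ∀ z, SmoothFieldAt Y z) (hs : SmoothSection ι s) :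
    D.curvatureOnFields X Y (fun z => f z • s z) x = f x • D.curvatureOnFields X Y s x := by
  have := FiniteDimensional.complete ℂ G
  have e (Z W : Π z : V, TangentSpace 𝓘(ℂ, G) z) (hZ : ∀ z, SmoothFieldAt Z z) :
      D.toFun (fun z => D.toFun (fun z => f z • s z) z (Z z)) x (W x) =
        differential (fun z => differential f z (Z z)) x (W x) • s x +
        differential f x (Z x) • D.toFun s x (W x) + (differential f x (W x) • D.toFun s x (Z x) +
        f x • D.toFun (fun z => D.toFun s z (Z z)) x (W x)) := by
    have h1 : (fun z => D.toFun (fun z => f z • s z) z (Z z)) =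
        fun z => differential f z (Z z) • s z + f z • D.toFun s z (Z z) :=
      funext fun z => D.leibniz f s hf hs z (Z z)
    have hd := smoothFun_differential hf hZ
    rw [h1, D.map_add _ _ (SmoothSection.smul hι hd hs)
      (SmoothSection.smul hι hf (D.smooth_deriv hs hZ)), D.leibniz _ _ hd hs,
      D.leibniz _ _ hf (D.smooth_deriv hs hZ)]
  simp only [curvatureOnFields]
  rw [e Y X hY, e X Y hX, D.leibniz f s hf hs, differential_realBracket hf hX hY]
  simp only [smul_sub, sub_smul]
  abel

lemma curvatureOnFields_add_section (hX : ∀ z, SmoothFieldAt X z) (hY : ∀ z, SmoothFieldAt Y z)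
    (hs : SmoothSection ι s) (ht : SmoothSection ι t) :
    D.curvatureOnFields X Y (fun z => s z + t z) x =
      D.curvatureOnFields X Y s x + D.curvatureOnFields X Y t x := by
  have h (Z : Π z : V, TangentSpace 𝓘(ℂ, G) z) : (fun z => D.toFun (fun z => s z + t z) z (Z z)) =
      fun z => D.toFun s z (Z z) + D.toFun t z (Z z) := funext fun z => D.map_add s t hs ht z _
  simp only [curvatureOnFields]
  rw [h X, h Y, D.map_add _ _ (D.smooth_deriv hs hX) (D.smooth_deriv ht hX),
    D.map_add _ _ (D.smooth_deriv hs hY) (D.smooth_deriv ht hY), D.map_add s t hs ht]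
  abel

include hι in
lemma curvatureOnFields_sum_left {α : Type*} (a : Finset α)
    {Z : α → Π z : V, TangentSpace 𝓘(ℂ, G) z} (hZ : ∀ i z, SmoothFieldAt (Z i) z)
    (hY : ∀ z, SmoothFieldAt Y z) (hs : SmoothSection ι s) :
    D.curvatureOnFields (fun z => ∑ i ∈ a, Z i z) Y s x =
      ∑ i ∈ a, D.curvatureOnFields (Z i) Y s x := by
  classical
  induction a using Finset.induction_on with
  | empty =>
    have := D.curvatureOnFields_smul_left hι (x := x) (f := fun _ => 0) contMDiff_const hY hY hs
    simpa using this
  | insert i a hi ih =>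
    simp only [Finset.sum_insert hi]
    rw [D.curvatureOnFields_add_left (hZ i) (smoothField_sum a hZ) hY hs, ih]

include hι in
lemma curvatureOnFields_sum_section {α : Type*} (a : Finset α)
    {u : α → Π z : V, NormalSpace (E := E) (G := G) ι z} (hu : ∀ i, SmoothSection ι (u i))
    (hX : ∀ z, SmoothFieldAt X z) (hY : ∀ z, SmoothFieldAt Y z) :
    D.curvatureOnFields X Y (fun z => ∑ i ∈ a, u i z) x =
      ∑ i ∈ a, D.curvatureOnFields X Y (u i) x := by
  classical
  induction a using Finset.induction_on with
  | empty =>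
    have := D.curvatureOnFields_smul_section hι (x := x) (f := fun _ => 0) contMDiff_const hX hY
      smoothSection_zero
    simpa using this
  | insert i a hi ih =>
    simp only [Finset.sum_insert hi]
    rw [D.curvatureOnFields_add_section hX hY (hu i) (smoothSection_sum a hu), ih]

include hι in
/-- The curvature depends on the first vector field only through its value at the point. -/
lemma curvatureOnFields_eq_left (hX : ∀ z, SmoothFieldAt X z) (hX' : ∀ z, SmoothFieldAt X' z)
    (hY : ∀ z, SmoothFieldAt Y z) (hs : SmoothSection ι s) (h : X x = X' x) :
    D.curvatureOnFields X Y s x = D.curvatureOnFields X' Y s x := by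
  have := FiniteDimensional.complete ℂ G
  obtain ⟨m, Z, L, hZ, hframe⟩ := exists_field_frame (G := G) x
  have key (W : Π z : V, TangentSpace 𝓘(ℂ, G) z) (hW : ∀ z, SmoothFieldAt W z) :
      D.curvatureOnFields W Y s x = ∑ i, (L i (W x) : ℂ) • D.curvatureOnFields (Z i) Y s x := by
    obtain ⟨f, hf, hfx, hW'⟩ := hframe W hW
    have hfZ (i) (z) : SmoothFieldAt (fun z => (f i z : ℂ) • Z i z) z := (hZ i z).smul (hf i z)
    rw [D.curvatureOnFields_congr hι hW (smoothField_sum Finset.univ hfZ) hY hY hs hs hW'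
      (.of_forall fun _ => rfl) (.of_forall fun _ => rfl),
      D.curvatureOnFields_sum_left hι _ hfZ hY hs]
    refine Finset.sum_congr rfl fun i _ => ?_
    rw [D.curvatureOnFields_smul_left hι (hf i) (hZ i) hY hs, hfx]
  rw [key X hX, key X' hX', h]

include hι in
/-- The curvature depends on the section only through its value at the point. -/
lemma curvatureOnFields_eq_section (hX : ∀ z, SmoothFieldAt X z) (hY : ∀ z, SmoothFieldAt Y z)
    (hs : SmoothSection ι s) (ht : SmoothSection ι t) (h : s x = t x) :
    D.curvatureOnFields X Y s x = D.curvatureOnFields X Y t x := by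
  obtain ⟨m, u, L, hu, hframe⟩ := exists_section_frame hι x
  have key (r : Π z : V, NormalSpace (E := E) (G := G) ι z) (hr : SmoothSection ι r) :
      D.curvatureOnFields X Y r x = ∑ i, L i (r x) • D.curvatureOnFields X Y (u i) x := by
    obtain ⟨f, hf, hfx, hr'⟩ := hframe r hr
    have hfu (i) : SmoothSection ι (fun z => f i z • u i z) := SmoothSection.smul hι (hf i) (hu i)
    rw [D.curvatureOnFields_congr hι hX hX hY hY hr (smoothSection_sum Finset.univ hfu)
      (.of_forall fun _ => rfl) (.of_forall fun _ => rfl) hr',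
      D.curvatureOnFields_sum_section hι _ hfu hX hY]
    refine Finset.sum_congr rfl fun i _ => ?_
    rw [D.curvatureOnFields_smul_section hι (hf i) hX hY (hu i), hfx]
  rw [key s hs, key t ht, h]

include hι in
lemma curvatureOnFields_eq (hX : ∀ z, SmoothFieldAt X z) (hX' : ∀ z, SmoothFieldAt X' z)
    (hY : ∀ z, SmoothFieldAt Y z) (hY' : ∀ z, SmoothFieldAt Y' z) (hs : SmoothSection ι s)
    (ht : SmoothSection ι t) (h1 : X x = X' x) (h2 : Y x = Y' x) (h3 : s x = t x) :
    D.curvatureOnFields X Y s x = D.curvatureOnFields X' Y' t x := by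
  rw [D.curvatureOnFields_eq_left hι hX hX' hY hs h1, curvatureOnFields_swap,
    D.curvatureOnFields_eq_left hι hY hY' hX' hs h2, ← curvatureOnFields_swap,
    D.curvatureOnFields_eq_section hι hX' hY' hs ht h3]

omit [FiniteDimensional ℂ E] [T2Space M] in
/-- A smooth field, with constant coordinates near `x`, with a given value at `x`. -/
lemma _root_.CamachoSad.exists_const_field {c : OpenPartialHomeomorph V G}
    (hc : c ∈ maximalAtlas 𝓘(ℂ, G) ω V) (hx : x ∈ c.source) (g : G) :
    ∃ X : Π z : V, TangentSpace 𝓘(ℂ, G) z, (∀ z, SmoothFieldAt X z) ∧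
      ∀ᶠ z in 𝓝 x, X z = fieldOfCoord ℂ c (fun _ => g) z := by
  obtain ⟨χ, h1, h2⟩ := exists_smoothField_eventuallyEq (x := x)
    (A := fieldOfCoord ℂ c (fun _ => g)) (by
      filter_upwards [c.open_source.mem_nhds hx] with z hz
      exact smoothFieldAt_fieldOfCoord hc hz contDiffAt_const)
  exact ⟨_, h1, h2⟩

lemma _root_.CamachoSad.exists_smoothField (v : TangentSpace 𝓘(ℂ, G) x) :
    ∃ X : Π z : V, TangentSpace 𝓘(ℂ, G) z, (∀ z, SmoothFieldAt X z) ∧ X x = v := by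
  have hc := chart_mem_maximalAtlas (I := 𝓘(ℂ, G)) (n := ω) x
  have hx := mem_chart_source G x
  obtain ⟨X, h1, h2⟩ := exists_const_field hc hx (mfderiv 𝓘(ℂ, G) 𝓘(ℂ, G) (chartAt G x) x v)
  exact ⟨X, h1, h2.self_of_nhds.trans (mfderiv_symm_mfderiv hc (by simp) hx v)⟩

include hι in
/-- The curvature at a point may be computed with any extensions. -/
lemma curvature_eq (hX : ∀ z, SmoothFieldAt X z) (hY : ∀ z, SmoothFieldAt Y z)
    (hs : SmoothSection ι s) :
    D.curvature x (X x) (Y x) (s x) = D.curvatureOnFields X Y s x := by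
  have h1 (Z : Π z : V, TangentSpace 𝓘(ℂ, G) z) (hZ : ∀ z, SmoothFieldAt Z z) :=
    Classical.epsilon_spec (p := fun W : Π z : V, TangentSpace 𝓘(ℂ, G) z =>
      SmoothFieldOn W Set.univ ∧ W x = Z x) ⟨Z, (smoothFieldOn_iff isOpen_univ).2 fun z _ => hZ z, rfl⟩
  have h2 := Classical.epsilon_spec (p := fun t : Π z : V, NormalSpace (E := E) (G := G) ι z =>
      SmoothSection ι t ∧ t x = s x) ⟨s, hs, rfl⟩
  have h3 (Z : Π z : V, TangentSpace 𝓘(ℂ, G) z) (hZ : SmoothFieldOn Z univ) (z : V) :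
      SmoothFieldAt Z z := (smoothFieldOn_iff isOpen_univ).1 hZ z trivial
  exact D.curvatureOnFields_eq hι (h3 _ (h1 X hX).1) hX (h3 _ (h1 Y hY).1) hY h2.1 hs (h1 X hX).2
    (h1 Y hY).2 h2.2

include hι in
lemma curvature_add_left (v v' w : TangentSpace 𝓘(ℂ, G) x)
    (ξ : NormalSpace (E := E) (G := G) ι x) :
    D.curvature x (v + v') w ξ = D.curvature x v w ξ + D.curvature x v' w ξ := by
  have := FiniteDimensional.complete ℂ G
  obtain ⟨X, hX, rfl⟩ := exists_smoothField v
  obtain ⟨X', hX', rfl⟩ := exists_smoothField v'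
  obtain ⟨Y, hY, rfl⟩ := exists_smoothField w
  obtain ⟨s, hs, -, rfl⟩ := exists_holomorphic_section hι x ξ
  rw [D.curvature_eq hι hX hY hs, D.curvature_eq hι hX' hY hs,
    ← D.curvatureOnFields_add_left hX hX' hY hs,
    ← D.curvature_eq hι (fun z => (hX z).add (hX' z)) hY hs]

include hι in
lemma curvature_smul_left (r : ℝ) (v w : TangentSpace 𝓘(ℂ, G) x)
    (ξ : NormalSpace (E := E) (G := G) ι x) :
    D.curvature x ((r : ℂ) • v) w ξ = (r : ℂ) • D.curvature x v w ξ := by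
  have := FiniteDimensional.complete ℂ G
  obtain ⟨X, hX, rfl⟩ := exists_smoothField v
  obtain ⟨Y, hY, rfl⟩ := exists_smoothField w
  obtain ⟨s, hs, -, rfl⟩ := exists_holomorphic_section hι x ξ
  have hr : SmoothFun (E := G) fun _ : V => (r : ℂ) := contMDiff_const
  rw [D.curvature_eq hι hX hY hs, ← D.curvatureOnFields_smul_left hι (f := fun _ => r) hr hX hY hs,
    ← D.curvature_eq hι (fun z => (hX z).smul (hr z)) hY hs]

include hι in
lemma curvature_swap (v w : TangentSpace 𝓘(ℂ, G) x) (ξ : NormalSpace (E := E) (G := G) ι x) :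
    D.curvature x v w ξ = -D.curvature x w v ξ := by
  obtain ⟨X, hX, rfl⟩ := exists_smoothField v
  obtain ⟨Y, hY, rfl⟩ := exists_smoothField w
  obtain ⟨s, hs, -, rfl⟩ := exists_holomorphic_section hι x ξ
  rw [D.curvature_eq hι hX hY hs, D.curvature_eq hι hY hX hs, curvatureOnFields_swap]

include hι in
/-- The curvature of a Hermitian connection is skew-Hermitian. -/
lemma curvature_skew {h : HermitianMetric (E := E) (G := G) ι}
    (hh : ∀ s t, SmoothSection ι s → SmoothSection ι t → ∀ x v,
      differential (fun z => h.form z (s z) (t z)) x v =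
        h.form x (D.toFun s x v) (t x) + h.form x (s x) (D.toFun t x v))
    (v w : TangentSpace 𝓘(ℂ, G) x) (ξ η : NormalSpace (E := E) (G := G) ι x) :
    h.form x (D.curvature x v w ξ) η + h.form x ξ (D.curvature x v w η) = 0 := by
  have := FiniteDimensional.complete ℂ G
  obtain ⟨X, hX, rfl⟩ := exists_smoothField v
  obtain ⟨Y, hY, rfl⟩ := exists_smoothField w
  obtain ⟨s, hs, -, rfl⟩ := exists_holomorphic_section hι x ξ
  obtain ⟨t, ht, -, rfl⟩ := exists_holomorphic_section hι x η
  rw [D.curvature_eq hι hX hY hs, D.curvature_eq hι hX hY ht]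
  have e (Z W : Π z : V, TangentSpace 𝓘(ℂ, G) z) (hZ : ∀ z, SmoothFieldAt Z z) :
      differential (fun z => differential (fun z => h.form z (s z) (t z)) z (Z z)) x (W x) =
        (h.form x (D.toFun (fun z => D.toFun s z (Z z)) x (W x)) (t x) +
          h.form x (D.toFun s x (Z x)) (D.toFun t x (W x))) +
        (h.form x (D.toFun s x (W x)) (D.toFun t x (Z x)) +
          h.form x (s x) (D.toFun (fun z => D.toFun t z (Z z)) x (W x))) := by
    have h1 : (fun z => differential (fun z => h.form z (s z) (t z)) z (Z z)) = fun z =>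
        h.form z (D.toFun s z (Z z)) (t z) + h.form z (s z) (D.toFun t z (Z z)) :=
      funext fun z => hh s t hs ht z _
    rw [h1, differential_add (h.smooth _ _ (D.smooth_deriv hs hZ) ht)
      (h.smooth _ _ hs (D.smooth_deriv ht hZ)), hh _ _ (D.smooth_deriv hs hZ) ht,
      hh _ _ hs (D.smooth_deriv ht hZ)]
  have hb := differential_realBracket (h.smooth s t hs ht) hX hY x
  rw [e Y X hY, e X Y hX, hh s t hs ht] at hb
  simp only [curvatureOnFields, map_sub, LinearMap.sub_apply]
  linear_combination -hb

end NormalConnection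

end Curvature

/-! ### The Camacho-Sad action and the vanishing of the curvature along `F_V` -/

section Action

variable {E : Type*} [NormedAddCommGroup E] [NormedSpace ℂ E] [FiniteDimensional ℂ E]
  {G : Type*} [NormedAddCommGroup G] [NormedSpace ℂ G] [FiniteDimensional ℂ G]
  {M : Type*} [TopologicalSpace M] [T2Space M] [ChartedSpace E M] [IsManifold 𝓘(ℂ, E) ω M]
  {V : Type*} [TopologicalSpace V] [T2Space V] [ChartedSpace G V] [IsManifold 𝓘(ℂ, G) ω V]
  {ι : V → M} {F : Π y : M, Submodule ℂ (TangentSpace 𝓘(ℂ, E) y)} {p : ℕ}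

/-- The normal component of the bracket does not depend on the extensions. -/
lemma IsExtension.mkQ_bracket_eq (hι : Manifold.IsSmoothEmbedding 𝓘(ℂ, G) 𝓘(ℂ, E) ω ι)
    (hF : IsDistribution F p) (hFV : LeavesInvariant (G := G) ι F)
    {u : Π x : V, TangentSpace 𝓘(ℂ, G) x} {s : Π x : V, NormalSpace (E := E) (G := G) ι x} {z : V}
    {A B A' B' : Π y : M, TangentSpace 𝓘(ℂ, E) y} (h : IsExtension ι F u s z A B)
    (h' : IsExtension ι F u s z A' B') :
    (tangentImage (E := E) (G := G) ι z).mkQ (bracket A B (ι z)) =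
      (tangentImage (E := E) (G := G) ι z).mkQ (bracket A' B' (ι z)) := by
  have := FiniteDimensional.complete ℂ E
  obtain ⟨C, _, _, ⟨S⟩⟩ := exists_sliceChart hι z
  obtain ⟨U, hU, hzU, hA, hB, hAF, hAu, hBs⟩ := h
  obtain ⟨U', hU', hzU', hA', hB', hAF', hAu', hBs'⟩ := h'
  obtain ⟨U₀, hU₀, hzU₀, Z, hZ, hZF⟩ := hF (ι z)
  have hz := S.mem_source
  have hιz := S.maps z hz
  have hA := (smoothFieldOn_iff hU).1 hA _ hzU
  have hB := (smoothFieldOn_iff hU).1 hB _ hzU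
  have hA' := (smoothFieldOn_iff hU').1 hA' _ hzU'
  have hB' := (smoothFieldOn_iff hU').1 hB' _ hzU'
  refine S.normalCoord_injective hz ?_
  rw [S.normalCoord_mkQ hz, S.normalCoord_mkQ hz]
  have e1 := coordField_bracket S.cod_mem hιz hA hB
  have e2 := coordField_bracket S.cod_mem hιz hA' hB'
  rw [coordField_apply _ hιz, S.cod_apply hz] at e1 e2
  refine (congrArg S.nproj e1).trans (Eq.trans ?_ (congrArg S.nproj e2).symm)
  have hd {A : Π y : M, TangentSpace 𝓘(ℂ, E) y} (h : SmoothFieldAt A (ι z)) :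
      DifferentiableAt ℝ (coordField ℂ S.cod A) (S.incl (S.dom z)) := by
    have := ((smoothFieldAt_iff S.cod_mem hιz).1 h).differentiableAt (by simp)
    rwa [S.cod_apply hz] at this
  have hc : Tendsto S.dom.symm (𝓝 (S.dom z)) (𝓝 z) := by
    have := S.dom.continuousAt_symm (S.dom.map_source hz)
    rwa [ContinuousAt, S.dom.left_inv hz] at this
  have hιc : ContinuousAt ι z := (S.smooth z hz).continuousAt
  have hUU : ∀ᶠ g in 𝓝 (S.dom z), g ∈ S.dom.target ∧ ι (S.dom.symm g) ∈ U ∩ U' := by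
    filter_upwards [S.dom.open_target.mem_nhds (S.dom.map_source hz),
      hc.eventually (hιc.eventually ((hU.inter hU').mem_nhds ⟨hzU, hzU'⟩))] with g h1 h2
    exact ⟨h1, h2⟩
  have hval (A : Π y : M, TangentSpace 𝓘(ℂ, E) y) {z' : V} (hz' : z' ∈ S.dom.source) :
      coordField ℂ S.cod A (S.incl (S.dom z')) = S.dcod (ι z') (A (ι z')) := by
    rw [← S.cod_apply hz']
    exact coordField_apply A (S.maps z' hz')
  have hc' : Tendsto S.cod.symm (𝓝 (S.incl (S.dom z))) (𝓝 (ι z)) := by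
    have := S.cod.continuousAt_symm (S.cod.map_source hιz)
    rwa [ContinuousAt, S.cod.left_inv hιz, S.cod_apply hz] at this
  refine coordBracket_normal_eq (P := S.nproj) (Q := S.incl)
    (A := fun i => coordField ℂ S.cod (Z i)) (fun w hw => ⟨_, S.incl_tproj hw⟩)
    (hd hA) (hd hA') (hd hB) (hd hB') ?_ ?_ ?_ ?_ ?_ ?_ ?_
  · filter_upwards [hUU] with g hg
    have hg' := S.dom.map_target hg.1
    rw [← S.dom.right_inv hg.1, hval B hg', hval B' hg', ← S.normalCoord_mkQ hg',
      ← S.normalCoord_mkQ hg', ← hBs _ hg.2.1, ← hBs' _ hg.2.2]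
  · rw [hval A hz, hval A' hz, hAu z hzU, hAu' z hzU']
  · filter_upwards [hUU] with g hg
    have hg' := S.dom.map_target hg.1
    rw [← S.dom.right_inv hg.1, hval A' hg', hAu' _ hg.2.2]
    exact (congrArg S.nproj (S.dcod_mfderiv hg' _)).trans (S.nproj_incl _)
  · intro i
    have h1 := (holomorphicFieldOn_iff hU₀).1 (hZ i) _ hzU₀
    have h2 := ((holomorphicFieldAt_iff S.cod_mem hιz).1 h1).continuousAt
    rwa [S.cod_apply hz] at h2
  · have h1 := (hZF _ hzU₀).1.map' (S.dcod (ι z)).toLinearMap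
      (LinearMap.ker_eq_bot.2 fun v w hvw => S.dcod_injective hιz hvw)
    have h2 : (fun i => coordField ℂ S.cod (Z i) (S.incl (S.dom z))) =
        fun i => S.dcod (ι z) (Z i (ι z)) := funext fun i => hval (Z i) hz
    rw [h2]
    exact h1
  · intro i
    rw [hval (Z i) hz, ← S.mem_tangentImage_iff hz]
    refine hFV z ?_
    rw [← (hZF _ hzU₀).2]
    exact Submodule.subset_span ⟨i, rfl⟩
  · have hnear := hc'.eventually ((((hU.inter hU').inter hU₀).mem_nhds ⟨⟨hzU, hzU'⟩, hzU₀⟩))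
    filter_upwards [hnear] with w hw
    have h1 : A (S.cod.symm w) - A' (S.cod.symm w) ∈
        Submodule.span ℂ (Set.range fun i => Z i (S.cod.symm w)) := by
      rw [(hZF _ hw.2).2]
      exact Submodule.sub_mem _ (hAF _ hw.1.1) (hAF' _ hw.1.2)
    obtain ⟨k, hk⟩ := (Submodule.mem_span_range_iff_exists_fun ℂ).1 h1
    refine (Submodule.mem_span_range_iff_exists_fun ℂ).2 ⟨k, ?_⟩
    have h2 := congrArg (S.dcod (S.cod.symm w)) hk
    rw [map_sub, map_sum] at h2
    simp only [map_smul] at h2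
    exact h2

/-- The Camacho-Sad action may be computed with any extensions. -/
lemma action_eq (hι : Manifold.IsSmoothEmbedding 𝓘(ℂ, G) 𝓘(ℂ, E) ω ι)
    (hF : IsDistribution F p) (hFV : LeavesInvariant (G := G) ι F)
    {u : Π x : V, TangentSpace 𝓘(ℂ, G) x} {s : Π x : V, NormalSpace (E := E) (G := G) ι x} {z : V}
    {A B : Π y : M, TangentSpace 𝓘(ℂ, E) y} (h : IsExtension ι F u s z A B) :
    action ι F u s z = (tangentImage (E := E) (G := G) ι z).mkQ (bracket A B (ι z)) :=
  IsExtension.mkQ_bracket_eq hι hF hFV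
    (Classical.epsilon_spec (p := fun q : (Π y : M, TangentSpace 𝓘(ℂ, E) y) ×
      (Π y : M, TangentSpace 𝓘(ℂ, E) y) => IsExtension ι F u s z q.1 q.2) ⟨(A, B), h⟩) h

lemma holomorphicFieldAt_sum {α : Type*} (t : Finset α) {A : α → Π y : M, TangentSpace 𝓘(ℂ, E) y}
    (k : α → ℂ) {y : M} (hA : ∀ i, HolomorphicFieldAt (A i) y) :
    HolomorphicFieldAt (fun z => ∑ i ∈ t, k i • A i z) y := by
  have := FiniteDimensional.complete ℂ E
  have hc := chart_mem_maximalAtlas (I := 𝓘(ℂ, E)) (n := ω) y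
  have hy := mem_chart_source E y
  rw [holomorphicFieldAt_iff hc hy]
  have e : coordField ℂ (chartAt E y) (fun z => ∑ i ∈ t, k i • A i z) =
      fun w => ∑ i ∈ t, k i • coordField ℂ (chartAt E y) (A i) w := by
    funext w
    refine (map_sum (mfderiv 𝓘(ℂ, E) 𝓘(ℂ, E) (chartAt E y) ((chartAt E y).symm w)) _ _).trans ?_
    exact Finset.sum_congr rfl fun i _ => map_smul _ _ _
  rw [e]
  exact ContDiffAt.sum fun i _ => ((holomorphicFieldAt_iff hc hy).1 (hA i)).const_smul _

/-- A vector tangent to the distribution extends to a global section of `F_V`, holomorphic near the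
given point and there induced by a holomorphic section of `F`. -/
lemma exists_section_of_distribution (hι : Manifold.IsSmoothEmbedding 𝓘(ℂ, G) 𝓘(ℂ, E) ω ι)
    (hF : IsDistribution F p) (hFV : LeavesInvariant (G := G) ι F) {x : V}
    {v : TangentSpace 𝓘(ℂ, G) x} (hv : mfderiv 𝓘(ℂ, G) 𝓘(ℂ, E) ι x v ∈ F (ι x)) :
    ∃ u : Π x : V, TangentSpace 𝓘(ℂ, G) x, IsSectionOfRestriction ι F u ∧ u x = v ∧
      HolomorphicFieldAt u x ∧ ∃ U : Set M, IsOpen U ∧ ι x ∈ U ∧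
        ∃ A : Π y : M, TangentSpace 𝓘(ℂ, E) y, (∀ y ∈ U, HolomorphicFieldAt A y) ∧
          (∀ y ∈ U, A y ∈ F y) ∧
          ∀ z : V, ι z ∈ U → A (ι z) = mfderiv 𝓘(ℂ, G) 𝓘(ℂ, E) ι z (u z) := by
  have := FiniteDimensional.complete ℂ E
  have := FiniteDimensional.complete ℂ G
  obtain ⟨C, _, _, ⟨S⟩⟩ := exists_sliceChart hι x
  obtain ⟨U₀, hU₀, hxU₀, Z, hZ, hZF⟩ := hF (ι x)
  have hx := S.mem_source
  rw [← (hZF _ hxU₀).2, Submodule.mem_span_range_iff_exists_fun] at hv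
  obtain ⟨k, hk⟩ := hv
  set A : Π y : M, TangentSpace 𝓘(ℂ, E) y := fun y => ∑ i, k i • Z i y
  have hA (y) (hy : y ∈ U₀) : HolomorphicFieldAt A y :=
    holomorphicFieldAt_sum _ _ fun i => (holomorphicFieldOn_iff hU₀).1 (hZ i) y hy
  have hAF (y) (hy : y ∈ U₀) : A y ∈ F y := by
    rw [← (hZF y hy).2]
    exact (Submodule.mem_span_range_iff_exists_fun ℂ).2 ⟨k, rfl⟩
  set u₀ := fieldOfCoord ℂ S.dom (fun g => S.tproj (coordField ℂ S.cod A (S.incl g)))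
  have hu₀ {z : V} (hz : z ∈ S.dom.source) (hzU : ι z ∈ U₀) : HolomorphicFieldAt u₀ z := by
    refine holomorphicFieldAt_fieldOfCoord S.dom_mem hz ?_
    have h1 := (holomorphicFieldAt_iff S.cod_mem (S.maps z hz)).1 (hA _ hzU)
    rw [S.cod_apply hz] at h1
    exact S.tproj.contDiff.contDiffAt.comp (S.dom z)
      (h1.comp (S.dom z) S.incl.contDiff.contDiffAt)
  have hu₀A {z : V} (hz : z ∈ S.dom.source) (hzU : ι z ∈ U₀) :
      mfderiv 𝓘(ℂ, G) 𝓘(ℂ, E) ι z (u₀ z) = A (ι z) := by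
    refine S.dcod_injective (S.maps z hz) ((S.dcod_mfderiv hz _).trans ?_)
    have h1 : S.ddom z (u₀ z) = S.tproj (S.dcod (ι z) (A (ι z))) := by
      refine (coordField_apply u₀ hz).symm.trans ((coordField_fieldOfCoord S.dom_mem (by simp) _
        (S.dom.map_source hz)).trans ?_)
      rw [← S.cod_apply hz]
      exact congrArg S.tproj (coordField_apply A (S.maps z hz))
    rw [h1]
    exact S.incl_tproj ((S.mem_tangentImage_iff hz).1 (hFV z (hAF _ hzU)))
  have hιc : ContinuousAt ι x := (S.smooth x hx).continuousAt
  have hN : S.dom.source ∩ ι ⁻¹' U₀ ∈ 𝓝 x :=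
    inter_mem (S.dom.open_source.mem_nhds hx) (hιc (hU₀.mem_nhds hxU₀))
  obtain ⟨χ, hχ, hχ1, hχs⟩ := exists_cutoff (E := G) x hN
  obtain ⟨U₁, hU₁, hxU₁, hU₁N⟩ := exists_isOpen_preimage_subset hι.isEmbedding (inter_mem hχ1 hN)
  have hux {z : V} (hz : z ∈ ι ⁻¹' U₁) : χ z • u₀ z = u₀ z := by
    have : χ z = 1 := (hU₁N hz).1
    rw [this, one_smul]
  refine ⟨fun z => χ z • u₀ z, ⟨?_, fun z => ?_⟩, ?_, ?_, U₁ ∩ U₀, hU₁.inter hU₀, ⟨hxU₁, hxU₀⟩, A,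
    fun y hy => hA y hy.2, fun y hy => hAF y hy.2, fun z hz => ?_⟩
  · exact (smoothFieldOn_iff isOpen_univ).2 fun z _ => smoothFieldAt_cutoff_smul hχ
      (fun z hz => (hu₀ (hχs hz).1 (hχs hz).2).smoothFieldAt) z
  · rw [map_smul]
    by_cases hz : z ∈ tsupport χ
    · rw [hu₀A (hχs hz).1 (hχs hz).2]
      exact Submodule.smul_mem _ _ (hAF _ (hχs hz).2)
    · rw [image_eq_zero_of_notMem_tsupport hz, zero_smul]
      exact Submodule.zero_mem _
  · refine S.mfderiv_injective hx ?_
    change mfderiv 𝓘(ℂ, G) 𝓘(ℂ, E) ι x (χ x • u₀ x) = _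
    rw [← hk, hux (z := x) hxU₁, hu₀A hx hxU₀]
  · refine ContMDiffAt.congr_of_eventuallyEq (hu₀ hx hxU₀) ?_
    filter_upwards [hιc (hU₁.mem_nhds hxU₁)] with z hz
    rw [hux (z := z) hz]
  · change A (ι z) = mfderiv 𝓘(ℂ, G) 𝓘(ℂ, E) ι z (χ z • u₀ z)
    rw [hux (z := z) hz.1, hu₀A (hU₁N hz.1).2.1 hz.2]

lemma HolomorphicNear.congr (hι : IsEmbedding ι) {s t : Π x : V, NormalSpace (E := E) (G := G) ι x}
    {x : V} (hs : HolomorphicNear ι s x) (h : ∀ᶠ z in 𝓝 x, t z = s z) : HolomorphicNear ι t x := by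
  obtain ⟨U, hU, hxU, A, hA, hAs⟩ := hs
  obtain ⟨U₁, hU₁, hxU₁, hU₁N⟩ := exists_isOpen_preimage_subset hι h
  refine ⟨U ∩ U₁, hU.inter hU₁, ⟨hxU, hxU₁⟩, A, hA.mono inter_subset_left, fun z hz => ?_⟩
  have : t z = s z := hU₁N hz.2
  rw [this, hAs z hz.1]

lemma HolomorphicNear.eventually (hι : Continuous ι)
    {s : Π x : V, NormalSpace (E := E) (G := G) ι x} {x : V} (hs : HolomorphicNear ι s x) :
    ∀ᶠ z in 𝓝 x, HolomorphicNear ι s z := by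
  obtain ⟨U, hU, hxU, A, hA, hAs⟩ := hs
  filter_upwards [(hU.preimage hι).mem_nhds hxU] with z hz
  exact ⟨U, hU, hz, A, hA, hAs⟩

end Action

namespace NormalConnection

variable {E : Type*} [NormedAddCommGroup E] [NormedSpace ℂ E] [FiniteDimensional ℂ E]
  {G : Type*} [NormedAddCommGroup G] [NormedSpace ℂ G] [FiniteDimensional ℂ G]
  {M : Type*} [TopologicalSpace M] [T2Space M] [ChartedSpace E M] [IsManifold 𝓘(ℂ, E) ω M]
  {V : Type*} [TopologicalSpace V] [T2Space V] [ChartedSpace G V] [IsManifold 𝓘(ℂ, G) ω V]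
  {ι : V → M} {F : Π y : M, Submodule ℂ (TangentSpace 𝓘(ℂ, E) y)} {p : ℕ}
  {D : NormalConnection (E := E) (G := G) ι} {x : V}

/-- The curvature `K(v, ·)` in a direction `v` of the distribution is of type `(1,0)`. Extend `v` to a
holomorphic section `u` of `F_V`, `w` to a field `Y` with constant coordinates and `ξ` to a holomorphic
section `s`. Then `∇_u s` is the Camacho-Sad action of `u` on `s`, hence holomorphic, so that `∇ s` and
`∇ (∇_u s)` are both complex linear; so is `Y ↦ [u, Y]`, because `u` is holomorphic. -/
lemma curvature_add_I_smul (hι : Manifold.IsSmoothEmbedding 𝓘(ℂ, G) 𝓘(ℂ, E) ω ι)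
    (hF : IsDistribution F p) (hFV : LeavesInvariant (G := G) ι F) (hD : D.IsFVConnection F)
    {v : TangentSpace 𝓘(ℂ, G) x} (hv : mfderiv 𝓘(ℂ, G) 𝓘(ℂ, E) ι x v ∈ F (ι x))
    (w : TangentSpace 𝓘(ℂ, G) x) (ξ : NormalSpace (E := E) (G := G) ι x) :
    D.curvature x v w ξ + Complex.I • D.curvature x v (Complex.I • w) ξ = 0 := by
  have := FiniteDimensional.complete ℂ G
  have := FiniteDimensional.complete ℂ E
  have hιc := hι.isEmbedding.continuous
  obtain ⟨u, hu, rfl, hu', U, hU, hxU, A, hA, hAF, hAu⟩ :=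
    exists_section_of_distribution hι hF hFV hv
  obtain ⟨s, hs, hs', rfl⟩ := exists_holomorphic_section hι x ξ
  have hc := chart_mem_maximalAtlas (I := 𝓘(ℂ, G)) (n := ω) x
  have hx := mem_chart_source G x
  set c := chartAt G x
  obtain ⟨Y, hY, hYc⟩ := exists_const_field hc hx (mfderiv 𝓘(ℂ, G) 𝓘(ℂ, G) c x w)
  have hYx : Y x = w := hYc.self_of_nhds.trans (mfderiv_symm_mfderiv hc (by simp) hx w)
  subst hYx
  have hus (z : V) : SmoothFieldAt u z := (smoothFieldOn_iff isOpen_univ).1 hu.1 z trivial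
  have hIY (z : V) : SmoothFieldAt (fun z => Complex.I • Y z) z :=
    (hY z).smul (f := fun _ => Complex.I) contMDiffAt_const
  -- the derivative of `s` along `u` is holomorphic near `x`
  have ht : HolomorphicNear ι (fun z => D.toFun s z (u z)) x := by
    obtain ⟨U', hU', hxU', B, hB, hBs⟩ := hs'
    have hext : HolomorphicNear ι (action ι F u s) x := by
      refine ⟨U ∩ U', hU.inter hU', ⟨hxU, hxU'⟩, bracket A B,
        (holomorphicFieldOn_iff (hU.inter hU')).2 fun y hy =>
          HolomorphicFieldAt.bracket (hU.inter hU') (fun y hy => hA y hy.1)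
            (fun y hy => (holomorphicFieldOn_iff hU').1 hB y hy.2) hy, fun z hz => ?_⟩
      refine action_eq hι hF hFV ⟨U ∩ U', hU.inter hU', hz, ?_, ?_, fun y hy => hAF y hy.1,
        fun z hz => hAu z hz.1, fun z hz => hBs z hz.2⟩
      · exact (smoothFieldOn_iff (hU.inter hU')).2 fun y hy => (hA y hy.1).smoothFieldAt
      · exact (smoothFieldOn_iff (hU.inter hU')).2 fun y hy =>
          ((holomorphicFieldOn_iff hU').1 hB y hy.2).smoothFieldAt
    refine hext.congr hι.isEmbedding ?_
    have hs'' : HolomorphicNear ι s x := ⟨U', hU', hxU', B, hB, hBs⟩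
    filter_upwards [hs''.eventually hιc] with z hz
    -- `∇ s` is of type `(1,0)`, so its value on `(u - i J u) / 2` is the value on the real vector `u`
    rw [← hD.2 u s hu hs z, holDeriv, hD.1 s hs z hz, smul_smul, Complex.I_mul_I, neg_one_smul,
      sub_neg_eq_add, ← two_smul ℂ (D.toFun s z (u z)), smul_smul]
    norm_num
  have hts := D.smooth_deriv hs hus
  have hYs := D.smooth_deriv hs hY
  -- the bracket with a field with constant coordinates is complex linear in that field
  have hbr : realBracket u (fun z => Complex.I • Y z) x = Complex.I • realBracket u Y x := by
    refine (mdifferentiable_chart_of_mem hc (by simp)).mfderiv_injective hx ?_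
    have e1 := coordField_realBracket hc hx (hus x) (hIY x)
    have e2 := coordField_realBracket hc hx (hus x) (hY x)
    rw [coordField_apply _ hx] at e1 e2
    rw [_root_.map_smul]
    refine e1.trans (Eq.trans ?_ (congrArg (Complex.I • ·) e2).symm)
    obtain ⟨a, ha⟩ : ∃ a : G, a = mfderiv 𝓘(ℂ, G) 𝓘(ℂ, G) c x (Y x) := ⟨_, rfl⟩
    have hYc' : coordField ℂ c Y =ᶠ[𝓝 (c x)] fun _ => a := by
      refine (coordField_eventuallyEq_of hx hYc).trans ?_
      filter_upwards [c.open_target.mem_nhds (c.map_source hx)] with g hg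
      exact (coordField_fieldOfCoord hc (by simp) _ hg).trans ha.symm
    have hYc'' : (fun w => Complex.I • coordField ℂ c Y w) =ᶠ[𝓝 (c x)]
        fun _ => Complex.I • a :=
      hYc'.mono fun g hg => congrArg (Complex.I • ·) hg
    have hud := ((holomorphicFieldAt_iff hc hx).1 hu').differentiableAt (by simp)
    rw [coordField_smul (fun _ => Complex.I) Y]
    simp only [lieBracket]
    rw [hYc'.fderiv_eq, hYc''.fderiv_eq, hYc'.self_of_nhds, hud.fderiv_restrictScalars ℝ]
    simp
  have hYI : ∀ᶠ z in 𝓝 x, D.toFun s z (Complex.I • Y z) = Complex.I • D.toFun s z (Y z) := by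
    filter_upwards [hs'.eventually hιc] with z hz
    exact hD.1 s hs z hz _
  rw [D.curvature_eq hι hus hY hs, D.curvature_eq hι hus hIY hs]
  simp only [curvatureOnFields]
  rw [toFun_congr hι D (D.smooth_deriv hs hIY) (SmoothSection.const_smul hι Complex.I hYs) hYI,
    D.map_smul _ _ hYs, hD.1 _ hts x ht, hbr, hD.1 s hs x hs', ← smul_sub, ← smul_sub, smul_smul,
    Complex.I_mul_I, neg_one_smul, add_neg_cancel]

/-- The curvature of a Hermitian `F_V`-connection vanishes along `F_V`. -/
lemma curvature_eq_zero (hι : Manifold.IsSmoothEmbedding 𝓘(ℂ, G) 𝓘(ℂ, E) ω ι)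
    (hF : IsDistribution F p) (hFV : LeavesInvariant (G := G) ι F) (hD : D.IsFVConnection F)
    (hH : D.IsHermitian)
    {v : TangentSpace 𝓘(ℂ, G) x} (hv : mfderiv 𝓘(ℂ, G) 𝓘(ℂ, E) ι x v ∈ F (ι x))
    (w : TangentSpace 𝓘(ℂ, G) x) (ξ : NormalSpace (E := E) (G := G) ι x) :
    D.curvature x v w ξ = 0 := by
  obtain ⟨h, hh⟩ := hH
  have hz (η : NormalSpace (E := E) (G := G) ι x) :
      D.curvature x v w η = -(Complex.I • D.curvature x v (Complex.I • w) η) :=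
    eq_neg_of_add_eq_zero_left (curvature_add_I_smul hι hF hFV hD hv w η)
  -- `K(v, w) = -i K(v, i w)` and `K(v, i w)` is skew-Hermitian, so `K(v, w)` is both Hermitian and
  -- skew-Hermitian
  have hform (η) : h.form x (D.curvature x v w ξ) η = 0 := by
    have h1 := D.curvature_skew hι hh v w ξ η
    have h2 := D.curvature_skew hι hh v (Complex.I • w) ξ η
    rw [hz η, hz ξ] at h1
    rw [hz ξ]
    simp only [map_neg, LinearMap.neg_apply, _root_.map_smul, LinearMap.smul_apply, smul_eq_mul,
      LinearMap.map_smulₛₗ, Complex.conj_I] at h1 ⊢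
    linear_combination (1 / 2 : ℂ) * h1 - (1 / 2 : ℂ) * Complex.I * h2
  by_contra hne
  have := h.pos x _ hne
  rw [hform] at this
  simp at this

end NormalConnection

/-! ### Polynomials in two-forms -/

section Polarization

/-- The polarization identity for a product of linear forms: only the surjective choice functions
survive the alternating sum over subsets. -/
lemma sum_neg_one_pow_prod_sum {k : ℕ} (a : Fin k → Fin k → ℂ) :
    ∑ S : Finset (Fin k), (-1 : ℂ) ^ (k - S.card) * ∏ j, ∑ i ∈ S, a j i =
      ∑ σ : Equiv.Perm (Fin k), ∏ j, a j (σ j) := by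
  have h1 (S : Finset (Fin k)) : (-1 : ℂ) ^ (k - S.card) * ∏ j, ∑ i ∈ S, a j i =
      ∑ g : Fin k → Fin k, (if ∀ j, g j ∈ S then (-1 : ℂ) ^ (k - S.card) else 0) *
        ∏ j, a j (g j) := by
    rw [Finset.prod_univ_sum, Finset.mul_sum, ← Finset.sum_filter_add_sum_filter_not
      Finset.univ (fun g : Fin k → Fin k => ∀ j, g j ∈ S)]
    rw [Finset.sum_eq_zero (s := Finset.univ.filter fun g : Fin k → Fin k => ¬∀ j, g j ∈ S), add_zero]
    · refine Finset.sum_congr (by ext g; simp) fun g hg => ?_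
      rw [if_pos (by simpa using hg)]
    · intro g hg
      rw [if_neg (by simpa using hg), zero_mul]
  have h2 (g : Fin k → Fin k) :
      ∑ S : Finset (Fin k), (if ∀ j, g j ∈ S then (-1 : ℂ) ^ (k - S.card) else 0) =
        if Function.Bijective g then 1 else 0 := by
    -- pass to complements: the subsets of `(range g)ᶜ` cancel unless it is empty
    rw [← (compl_involutive.toPerm (compl : Finset (Fin k) → _)).sum_comp _ _ (by simp)]
    have h3 (S : Finset (Fin k)) : (∀ j, g j ∈ Sᶜ) ↔ S ∈ (Finset.univ.image g)ᶜ.powerset := by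
      rw [Finset.mem_powerset, ← Finset.compl_subset_compl, compl_compl, Finset.image_subset_iff]
      simp
    have h4 (S : Finset (Fin k)) : k - Sᶜ.card = S.card := by
      have := S.card_add_card_compl
      rw [Fintype.card_fin] at this
      omega
    have h5 : (Finset.univ.image g)ᶜ = ∅ ↔ Function.Bijective g := by
      rw [← Finite.surjective_iff_bijective, Finset.compl_eq_empty_iff]
      simp [Finset.eq_univ_iff_forall, Function.Surjective]
    simp only [Function.Involutive.coe_toPerm, h3, h4]
    rw [Finset.sum_ite_mem, Finset.univ_inter]
    have h6 := congrArg (Int.cast : ℤ → ℂ)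
      (Finset.sum_powerset_neg_one_pow_card (x := (Finset.univ.image g)ᶜ))
    push_cast at h6
    rw [h6]
    simp only [h5]
  simp only [h1]
  rw [Finset.sum_comm]
  simp only [← Finset.sum_mul, h2]
  simp only [ite_mul, one_mul, zero_mul]
  rw [← Finset.sum_filter]
  refine (Finset.sum_bij (fun (σ : Equiv.Perm (Fin k)) _ => ⇑σ) ?_ ?_ ?_ ?_).symm
  · exact fun σ _ => Finset.mem_filter.2 ⟨Finset.mem_univ _, σ.bijective⟩
  · exact fun σ _ τ _ h => DFunLike.coe_injective h
  · exact fun g hg => ⟨Equiv.ofBijective g (Finset.mem_filter.1 hg).2, Finset.mem_univ _, rfl⟩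
  · exact fun σ _ => rfl

/-- The polarization of a homogeneous polynomial is multilinear. -/
lemma exists_multilinearMap_polarization {l k : ℕ} {φ : MvPolynomial (Fin l × Fin l) ℂ}
    (hφ : φ.IsHomogeneous k) :
    ∃ P : MultilinearMap ℂ (fun _ : Fin k => Matrix (Fin l) (Fin l) ℂ) ℂ,
      ∀ A, polarization φ k A = P A := by
  -- a monomial of degree `k` is a product of `k` matrix entries
  have hm (m) (hm : m ∈ φ.support) : ∃ e : Fin k → Fin l × Fin l, ∀ A : Fin l × Fin l → ℂ,
      ∏ ij, A ij ^ m ij = ∏ j, A (e j) := by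
    have hd : m.degree = k := by
      rw [Finsupp.degree_eq_weight_one]; exact hφ (MvPolynomial.mem_support_iff.1 hm)
    have hc : (Finsupp.toMultiset m).toList.length = k := by
      rw [Multiset.length_toList, Finsupp.card_toMultiset, ← hd]; rfl
    subst hc
    refine ⟨fun j => (Finsupp.toMultiset m).toList.get j, fun A => ?_⟩
    have h1 : ((Finsupp.toMultiset m).map A).prod = ∏ ij, A ij ^ m ij := by
      rw [Finsupp.toMultiset_map, Finsupp.prod_toMultiset, Finsupp.prod_mapDomain_index (by simp)
        (by simp [pow_add]), Finsupp.prod_fintype _ _ (by simp)]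
    rw [← h1]
    conv_lhs => rw [← Multiset.coe_toList (Finsupp.toMultiset m), Multiset.map_coe,
      Multiset.prod_coe]
    exact (Fin.prod_univ_fun_getElem _ _).symm
  have hM (m) (hm' : m ∈ φ.support) :
      ∃ P : MultilinearMap ℂ (fun _ : Fin k => Matrix (Fin l) (Fin l) ℂ) ℂ, ∀ A,
        ∑ S : Finset (Fin k), (-1 : ℂ) ^ (k - S.card) * ∏ ij, (∑ i ∈ S, A i) ij.1 ij.2 ^ m ij =
          P A := by
    obtain ⟨e, he⟩ := hm m hm'
    refine ⟨∑ σ : Equiv.Perm (Fin k), ((MultilinearMap.mkPiAlgebra ℂ (Fin k) ℂ).compLinearMap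
      fun j => Matrix.entryLinearMap ℂ ℂ (e j).1 (e j).2).domDomCongr σ, fun A => ?_⟩
    simp only [sum_apply, MultilinearMap.domDomCongr_apply,
      MultilinearMap.compLinearMap_apply, MultilinearMap.mkPiAlgebra_apply,
      Matrix.entryLinearMap_apply]
    rw [← sum_neg_one_pow_prod_sum (fun j i => A i (e j).1 (e j).2)]
    refine Finset.sum_congr rfl fun S _ => ?_
    rw [he fun ij => (∑ i ∈ S, A i) ij.1 ij.2]
    simp only [Matrix.sum_apply]
  choose! P hP using hM
  refine ⟨(k.factorial : ℂ)⁻¹ • ∑ m ∈ φ.support, φ.coeff m • P m, fun A => ?_⟩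
  simp only [polarization, evalMatrix, MvPolynomial.eval_eq', smul_apply,
    sum_apply, smul_eq_mul]
  congr 1
  simp only [Finset.mul_sum]
  rw [Finset.sum_comm]
  refine Finset.sum_congr rfl fun m hm' => ?_
  rw [← hP m hm', Finset.mul_sum]
  exact Finset.sum_congr rfl fun S _ => mul_left_comm _ _ _

end Polarization

/-- An alternating form that vanishes as soon as one argument lies in `W` is zero when its degree
exceeds the codimension of `W`. -/
lemma alternatingMap_eq_zero_of_finrank_quotient_lt {K T N α : Type*} [Field K] [AddCommGroup T]
    [Module K T] [FiniteDimensional K T] [AddCommGroup N] [Module K N] [Fintype α]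
    (f : T [⋀^α]→ₗ[K] N) (W : Submodule K T) (hf : ∀ v i, v i ∈ W → f v = 0)
    (hW : Module.finrank K (T ⧸ W) < Fintype.card α) (v : α → T) : f v = 0 := by
  classical
  have hdep : ¬LinearIndependent K fun i => W.mkQ (v i) := fun h =>
    absurd h.fintype_card_le_finrank (not_le.2 hW)
  obtain ⟨c, hc, j, hj⟩ := Fintype.not_linearIndependent_iff.1 hdep
  -- a combination of the arguments lies in `W`, and can replace one of them
  have hmem : ∑ i, c i • v i ∈ W := by
    rw [← Submodule.Quotient.mk_eq_zero, ← Submodule.mkQ_apply, map_sum]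
    simpa using hc
  have h0 := hf (Function.update v j (∑ i, c i • v i)) j (by simpa using hmem)
  rw [f.map_update_sum, Finset.sum_eq_single j] at h0
  · rw [f.map_update_smul, Function.update_eq_self] at h0
    exact (smul_eq_zero.1 h0).resolve_left hj
  · intro i _ hij
    rw [f.map_update_smul, f.map_update_self _ hij.symm, smul_zero]
  · simp

section EvalForm

variable {T : Type*} [AddCommGroup T] [Module ℂ T] {l k : ℕ}
  {φ : MvPolynomial (Fin l × Fin l) ℂ} {κ : T → T → Matrix (Fin l) (Fin l) ℂ}

/-- The product of `k` two-forms, before alternation, is multilinear. -/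
lemma exists_multilinearMap_comp (P : MultilinearMap ℂ (fun _ : Fin k => Matrix (Fin l) (Fin l) ℂ) ℂ)
    (hadd : ∀ v v' w, κ (v + v') w = κ v w + κ v' w)
    (hsmul : ∀ (r : ℝ) v w, κ ((r : ℂ) • v) w = (r : ℂ) • κ v w)
    (hswap : ∀ v w, κ v w = -κ w v) :
    ∃ Q : MultilinearMap ℝ (fun _ : Fin (2 * k) => T) ℂ,
      ∀ v, Q v = P fun i => κ (v ⟨2 * i.1, by omega⟩) (v ⟨2 * i.1 + 1, by omega⟩) := by
  have hadd' (v w w') : κ v (w + w') = κ v w + κ v w' := by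
    rw [hswap, hadd, neg_add, ← hswap, ← hswap]
  have hsmul' (r : ℝ) (v w) : κ v ((r : ℂ) • w) = (r : ℂ) • κ v w := by
    rw [hswap, hsmul, ← smul_neg, ← hswap]
  -- changing one argument changes a single factor, and linearly
  have key (v : Fin (2 * k) → T) (m : Fin (2 * k)) : ∃ (i : Fin k)
      (L : T → Matrix (Fin l) (Fin l) ℂ), (∀ x y, L (x + y) = L x + L y) ∧
      (∀ (r : ℝ) x, L ((r : ℂ) • x) = (r : ℂ) • L x) ∧
      ∀ x, (fun i : Fin k => κ (Function.update v m x ⟨2 * i.1, by omega⟩)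
        (Function.update v m x ⟨2 * i.1 + 1, by omega⟩)) =
        Function.update (fun i : Fin k => κ (v ⟨2 * i.1, by omega⟩) (v ⟨2 * i.1 + 1, by omega⟩))
          i (L x) := by
    have hm := m.2
    rcases Nat.even_or_odd' m.1 with ⟨c, hc | hc⟩
    · refine ⟨⟨c, by omega⟩, fun x => κ x (v ⟨2 * c + 1, by omega⟩), fun x y => hadd _ _ _,
        fun r x => hsmul _ _ _, fun x => funext fun i => ?_⟩
      have h2 : (⟨2 * i.1 + 1, by omega⟩ : Fin (2 * k)) ≠ m := by
        intro h; have := congrArg Fin.val h; simp only at this; omega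
      by_cases hi : i = ⟨c, by omega⟩
      · subst hi
        have h1 : (⟨2 * c, by omega⟩ : Fin (2 * k)) = m := Fin.ext hc.symm
        rw [Function.update_self, Function.update_of_ne h2, h1, Function.update_self]
      · have h1 : (⟨2 * i.1, by omega⟩ : Fin (2 * k)) ≠ m := by
          intro h; have := congrArg Fin.val h; refine hi (Fin.ext ?_); simp only at this ⊢; omega
        rw [Function.update_of_ne hi, Function.update_of_ne h1, Function.update_of_ne h2]
    · refine ⟨⟨c, by omega⟩, fun x => κ (v ⟨2 * c, by omega⟩) x, fun x y => hadd' _ _ _,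
        fun r x => hsmul' _ _ _, fun x => funext fun i => ?_⟩
      have h1 : (⟨2 * i.1, by omega⟩ : Fin (2 * k)) ≠ m := by
        intro h; have := congrArg Fin.val h; simp only at this; omega
      by_cases hi : i = ⟨c, by omega⟩
      · subst hi
        have h2 : (⟨2 * c + 1, by omega⟩ : Fin (2 * k)) = m := Fin.ext hc.symm
        rw [Function.update_self, Function.update_of_ne h1, h2, Function.update_self]
      · have h2 : (⟨2 * i.1 + 1, by omega⟩ : Fin (2 * k)) ≠ m := by
          intro h; have := congrArg Fin.val h; refine hi (Fin.ext ?_); simp only at this ⊢; omega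
        rw [Function.update_of_ne hi, Function.update_of_ne h1, Function.update_of_ne h2]
  refine ⟨⟨fun v => P fun i => κ (v ⟨2 * i.1, by omega⟩) (v ⟨2 * i.1 + 1, by omega⟩), ?_, ?_⟩,
    fun v => rfl⟩
  · intro inst v m x y
    obtain rfl := Subsingleton.elim inst (instDecidableEqFin _)
    obtain ⟨i, L, hL, -, h⟩ := key v m
    rw [h, h, h, hL, P.map_update_add]
  · intro inst v m r x
    obtain rfl := Subsingleton.elim inst (instDecidableEqFin _)
    obtain ⟨i, L, -, hL, h⟩ := key v m
    rw [h, h, ← Complex.coe_smul, hL, P.map_update_smul, Complex.coe_smul]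

/-- If a matrix of two-forms is annihilated by the vectors of `W`, then the invariant polynomials of
degree exceeding the complex codimension of `W` vanish on it. -/
lemma evalForm_eq_zero [FiniteDimensional ℂ T] (hφ : φ.IsHomogeneous k)
    (hadd : ∀ v v' w, κ (v + v') w = κ v w + κ v' w)
    (hsmul : ∀ (r : ℝ) v w, κ ((r : ℂ) • v) w = (r : ℂ) • κ v w)
    (hswap : ∀ v w, κ v w = -κ w v) (W : Submodule ℂ T) (hW : ∀ v ∈ W, ∀ w, κ v w = 0)
    (hk : Module.finrank ℂ (T ⧸ W) < k) (v : Fin (2 * k) → T) : evalForm φ k κ v = 0 := by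
  obtain ⟨P, hP⟩ := exists_multilinearMap_polarization hφ
  obtain ⟨Q, hQ⟩ := exists_multilinearMap_comp P hadd hsmul hswap
  have hW' (v) (hv : v ∈ W) (w) : κ w v = 0 := by rw [hswap, hW v hv, neg_zero]
  have hQ0 (v : Fin (2 * k) → T) (m : Fin (2 * k)) (hm : v m ∈ W) : Q v = 0 := by
    have hm' := m.2
    rw [hQ]
    rcases Nat.even_or_odd' m.1 with ⟨c, hc | hc⟩
    · have h1 : (⟨2 * c, by omega⟩ : Fin (2 * k)) = m := Fin.ext hc.symm
      exact P.map_coord_zero ⟨c, by omega⟩ (hW _ (by rwa [h1]) _)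
    · have h1 : (⟨2 * c + 1, by omega⟩ : Fin (2 * k)) = m := Fin.ext hc.symm
      exact P.map_coord_zero ⟨c, by omega⟩ (hW' _ (by rwa [h1]) _)
  have e : evalForm φ k κ v = ((2 : ℂ) ^ k)⁻¹ * MultilinearMap.alternatization Q v := by
    simp only [evalForm, hP, MultilinearMap.alternatization_apply,
      MultilinearMap.domDomCongr_apply, hQ, Units.smul_def, zsmul_eq_mul]
  have : FiniteDimensional ℝ T := FiniteDimensional.complexToReal T
  rw [e, alternatingMap_eq_zero_of_finrank_quotient_lt _ (W.restrictScalars ℝ), mul_zero]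
  · intro v m hm
    rw [MultilinearMap.alternatization_apply]
    refine Finset.sum_eq_zero fun σ _ => ?_
    rw [MultilinearMap.domDomCongr_apply, hQ0 _ (σ.symm m) (by simpa using hm), smul_zero]
  · rw [(Submodule.Quotient.restrictScalarsEquiv ℝ W).finrank_eq, finrank_real_of_complex,
      Fintype.card_fin]
    omega

end EvalForm

end CamachoSad

end

/-! ### The vanishing theorem -/

theorem corollary6p5
    {E : Type*} [NormedAddCommGroup E] [NormedSpace ℂ E] [FiniteDimensional ℂ E]
    {G : Type*} [NormedAddCommGroup G] [NormedSpace ℂ G] [FiniteDimensional ℂ G]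
    {M : Type*} [TopologicalSpace M] [T2Space M] [SecondCountableTopology M]
    [ChartedSpace E M] [IsManifold 𝓘(ℂ, E) ω M]
    {V : Type*} [TopologicalSpace V] [ChartedSpace G V] [IsManifold 𝓘(ℂ, G) ω V]
    (n d p : ℕ) (hn : Module.finrank ℂ E = n) (hd : Module.finrank ℂ G = d)
    (ι : V → M) (hι : Manifold.IsSmoothEmbedding 𝓘(ℂ, G) 𝓘(ℂ, E) ω ι)
    (F : Π y : M, Submodule ℂ (TangentSpace 𝓘(ℂ, E) y))
    (hF : CamachoSad.IsDistribution F p)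
    (hFV : CamachoSad.LeavesInvariant (G := G) ι F)
    (D : CamachoSad.NormalConnection (E := E) (G := G) ι)
    (hD : D.IsFVConnection F) (hH : D.IsHermitian)
    (k : ℕ) (φ : MvPolynomial (Fin (n - d) × Fin (n - d)) ℂ)
    (hφ : φ.IsHomogeneous k) (hinv : CamachoSad.IsInvariant φ)
    (hk : (k : ℤ) > (d : ℤ) - (p : ℤ)) :
    ∀ (x : V) (b : Module.Basis (Fin (n - d)) ℂ (CamachoSad.NormalSpace (E := E) (G := G) ι x))
      (v : Fin (2 * k) → TangentSpace 𝓘(ℂ, G) x),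
      D.chernForm φ k b v = 0 := by
  intro x b v
  have := hι.isEmbedding.t2Space
  have : FiniteDimensional ℂ (TangentSpace 𝓘(ℂ, G) x) := inferInstanceAs (FiniteDimensional ℂ G)
  have hdT : Module.finrank ℂ (TangentSpace 𝓘(ℂ, G) x) = d := hd
  obtain ⟨C, _, _, ⟨S⟩⟩ := CamachoSad.exists_sliceChart hι x
  have hinj := S.mfderiv_injective S.mem_source
  set W : Submodule ℂ (TangentSpace 𝓘(ℂ, G) x) :=
    (F (ι x)).comap (mfderiv 𝓘(ℂ, G) 𝓘(ℂ, E) ι x).toLinearMap with hWdef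
  have hW : Module.finrank ℂ W = p := by
    obtain ⟨U, -, hxU, A, -, hA⟩ := hF (ι x)
    obtain ⟨h1, h2⟩ := hA _ hxU
    have h3 : W.map (mfderiv 𝓘(ℂ, G) 𝓘(ℂ, E) ι x).toLinearMap = F (ι x) := by
      rw [hWdef, Submodule.map_comap_eq]
      exact inf_eq_right.2 (hFV x)
    rw [(Submodule.equivMapOfInjective _ hinj W).finrank_eq, h3, ← h2, finrank_span_eq_card h1,
      Fintype.card_fin]
  have hq := W.finrank_quotient_add_finrank
  have hκ : CamachoSad.evalForm φ k (D.curvatureMatrix b) v = 0 := by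
    refine CamachoSad.evalForm_eq_zero hφ ?_ ?_ ?_ W ?_ (by omega) v
    · intro v v' w
      ext i j
      simp [CamachoSad.NormalConnection.curvatureMatrix, D.curvature_add_left hι]
    · intro r v w
      ext i j
      simp only [CamachoSad.NormalConnection.curvatureMatrix, D.curvature_smul_left hι]
      exact congrArg (· i) (b.repr.map_smul (r : ℂ) _)
    · intro v w
      ext i j
      simp [CamachoSad.NormalConnection.curvatureMatrix, D.curvature_swap hι v w]
    · intro v hv w
      ext i j
      simp [CamachoSad.NormalConnection.curvatureMatrix,
        CamachoSad.NormalConnection.curvature_eq_zero hι hF hFV hD hH hv]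
  rw [CamachoSad.NormalConnection.chernForm, hκ, mul_zero]
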